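/- Let $D$ be a discrete valuation ring with quotient field $K$, let $\mathsf v\colon K\to\mathbb Z\cup\{\infty\}$ be its normalized additive valuation, and let $R$ be a $D$-order in the quaternion algebra $M_2(K)$, that is, a subring of $M_2(K)$ containing $D$ which is finitely generated as a $D$-module and satisfies $KR=M_2(K)$. Let $\operatorname{nr}=\det\colon M_2(K)\to K$ be the reduced norm, let $J(R)$ be the Jacobson radical of $R$, and let $R^\bullet$ be the multiplicative monoid of non-zero-divisors of $R$. An atom of $R^\bullet$ is a non-unit $u\in R^\bullet$ such that $u=ab$ with $a,b\in R^\bullet$ implies that $a$ or $b$ is a unit. An Eichler order is an intersection of two (not necessarily distinct) maximal $D$-orders of $M_2(K)$. 1. There exists $z\in J(R)\setminus J(R)^2$ with $\operatorname{nr}(z)=0$. 2. If $R$ is not an Eichler order, then there exists $N\in\mathbb N_0$ such that for every integer $n\ge N$ there exists an atom $u$ of $R^\bullet$ with $\mathsf v(\operatorname{nr}(u))=2n$. Consequently the elasticity $\rho(R^\bullet)=\sup_{a\in R^\bullet}\rho(a)$ is infinite. Here, for a non-unit $a\in R^\bullet$, $\rho(a)=\sup\mathsf L(a)/\min\mathsf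 L(a)$ with $\mathsf L(a)=\{k : a=u_1\cdots u_k \text{ for some atoms } u_1,\dots,u_k \text{ of } R^\bullet\}$, and $\rho(a)=1$ for units $a$. -/

import Mathlib

open scoped nonZeroDivisors ENNReal

/-- A subalgebra `R` of a `K`-algebra `A` is a `D`-order in `A` if it is finitely generated as a
`D`-module and `K R = A`. -/
structure IsOrder {D : Type*} (K : Type*) {A : Type*} [CommRing D] [Field K] [Ring A]
    [Algebra D A] [Algebra K A] (R : Subalgebra D A) : Prop where
  fg : (Subalgebra.toSubmodule R).FG
  span_eq_top : Submodule.span K (R : Set A) = ⊤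

/-- A `D`-order in `A` that is not properly contained in another `D`-order in `A`. -/
def IsMaximalOrder {D : Type*} (K : Type*) {A : Type*} [CommRing D] [Field K] [Ring A]
    [Algebra D A] [Algebra K A] (R : Subalgebra D A) : Prop :=
  Maximal (fun S : Subalgebra D A => IsOrder K S) R

/-- An Eichler order is the intersection of two (not necessarily distinct) maximal orders. -/
def IsEichlerOrder {D : Type*} (K : Type*) {A : Type*} [CommRing D] [Field K] [Ring A]
    [Algebra D A] [Algebra K A] (R : Subalgebra D A) : Prop :=
  ∃ O₁ O₂ : Subalgebra D A, IsMaximalOrder K O₁ ∧ IsMaximalOrder K O₂ ∧ R = O₁ ⊓ O₂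

/-- The reduced norm of the quaternion algebra `M₂(K)`, which is the determinant. -/
def nr {K : Type*} [Field K] (x : Matrix (Fin 2) (Fin 2) K) : K := x.det

open Classical in
/-- The additive valuation `K → ℤ ∪ {∞}` of the discrete valuation ring `D` with quotient field
`K`, normalized so that prime elements of `D` have valuation one. -/
noncomputable def sv (D : Type*) {K : Type*} [CommRing D] [IsDomain D]
    [IsDiscreteValuationRing D] [Field K] [Algebra D K] [IsFractionRing D K] (x : K) :
    WithTop ℤ :=
  if x = 0 then ⊤
  else ((-WithZero.log ((IsDiscreteValuationRing.maximalIdeal D).valuation K x) : ℤ) : WithTop ℤ)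

/-- The set of lengths of `a`: all `k` such that `a = ε u₁ ⋯ u_k` with a unit `ε` and atoms
`u₁, …, u_k`. For a non-unit `a` (so that `k ≥ 1`) the unit can be absorbed into `u₁`. -/
def lengthSet {H : Type*} [Monoid H] (a : H) : Set ℕ :=
  {k | ∃ (ε : Hˣ) (l : List H), (∀ u ∈ l, Irreducible u) ∧ l.length = k ∧ a = ε * l.prod}

open Classical in
/-- The elasticity `sup L(a) / min L(a)` of an element, which is `1` for units. -/
noncomputable def elementElasticity {H : Type*} [Monoid H] (a : H) : ℝ≥0∞ :=
  if IsUnit a then 1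
  else (⨆ k ∈ lengthSet a, (k : ℝ≥0∞)) / ((sInf (lengthSet a) : ℕ) : ℝ≥0∞)

/-- The elasticity of a monoid. -/
noncomputable def elasticity (H : Type*) [Monoid H] : ℝ≥0∞ :=
  ⨆ a : H, elementElasticity a

open IsLocalRing (maximalIdeal)

/-! Norms and traces of elements of `R` lie in `D`, and units, zero-divisors and the radical `J` of
`R` can be read off from them. The proof splits according to whether every non-unit of `R` lies in
`J`.

If so, let `ϖ` be a uniformizer. Modulo `ϖR` the elements of `J` square to zero, hence anticommute,
and this forces the image of `J²` to be at most one-dimensional (`exists_mul_mem_span_add`). The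
matrices in `R` with zero second column are singular and form a saturated `D`-submodule of rank two,
whose image modulo `ϖR` is two-dimensional; so one of them is a `z` outside `J²`. Every non-unit
outside `J²` is an atom, and adding to `z` a suitable element of `J²` produces atoms of norm
valuation `2n` for all large `n`. For such an atom `u`, the product of `u` and its conjugate is a
unit times `ϖ^(2n)`, which also factors into at least `2n` atoms; this gives infinite elasticity.

If not, `R` contains a non-trivial idempotent (`exists_tr_eq_one_norm_eq_zero`). In a suitable basis
`R` is then `[[D, sD], [tD, D]]`, an Eichler order, and only the first claim remains: Nakayama's
lemma applied to the upper right entries of `J` yields `z`. -/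

theorem isUnit_one_add_of_mem_maximalIdeal {D : Type*} [CommRing D] [IsLocalRing D] {x : D}
    (hx : x ∈ maximalIdeal D) : IsUnit (1 + x) := by
  by_contra hc
  have := Ideal.sub_mem _ ((IsLocalRing.mem_maximalIdeal _).2 hc) hx
  rw [add_sub_cancel_right, ← Ideal.eq_top_iff_one] at this
  exact Ideal.IsPrime.ne_top' this

/-! ### Identities for trace, determinant and adjugate of 2 × 2 matrices. -/

section TwoByTwo

variable {K : Type*} [Field K]

/-- The polarization of the determinant of `2 × 2` matrices. -/
theorem det_add_fin_two (x y : Matrix (Fin 2) (Fin 2) K) :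
    (x + y).det = x.det + (x.trace * y.trace - (x * y).trace) + y.det := by
  simp [Matrix.det_fin_two, Matrix.trace_fin_two, Matrix.mul_apply, Fin.sum_univ_two]
  ring

theorem mul_self_fin_two (x : Matrix (Fin 2) (Fin 2) K) :
    x * x = x.trace • x - x.det • (1 : Matrix (Fin 2) (Fin 2) K) := by
  ext i j
  fin_cases i <;> fin_cases j <;>
    simp [Matrix.det_fin_two, Matrix.trace_fin_two, Matrix.mul_apply, Fin.sum_univ_two] <;> ring

theorem adjugate_eq_trace_smul_sub (x : Matrix (Fin 2) (Fin 2) K) :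
    x.adjugate = x.trace • (1 : Matrix (Fin 2) (Fin 2) K) - x := by
  ext i j
  fin_cases i <;> fin_cases j <;> simp [Matrix.adjugate_fin_two, Matrix.trace_fin_two]

theorem trace_mul_adjugate_fin_two (x y : Matrix (Fin 2) (Fin 2) K) :
    (x * y.adjugate).trace = x.trace * y.trace - (x * y).trace := by
  rw [adjugate_eq_trace_smul_sub, mul_sub, Matrix.trace_sub]
  simp [mul_comm]

end TwoByTwo

/-! ### Integrality of trace and determinant. -/

section Integrality

variable {D K : Type*} [CommRing D] [Field K] [Algebra D K]

/-- The roots of the characteristic polynomial of an integral matrix are integral. -/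
theorem isIntegral_of_mem_roots_charpoly {n L : Type*} [Fintype n] [DecidableEq n] [Field L]
    [Algebra D L] {x : Matrix n n L} (hx : IsIntegral D x) {μ : L} (hμ : μ ∈ x.charpoly.roots) :
    IsIntegral D μ := by
  obtain ⟨p, hp, hpx⟩ := hx
  refine ⟨p, hp, ?_⟩
  have h1 : μ ∈ spectrum L x :=
    Matrix.mem_spectrum_of_isRoot_charpoly (Polynomial.isRoot_of_mem_roots hμ)
  -- Spectral mapping: `p(μ)` lies in the spectrum of `p(x) = 0`, which contains no nonzero scalar.
  have h2 := spectrum.subset_polynomial_aeval x (p.map (algebraMap D L)) ⟨μ, h1, rfl⟩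
  have h3 : Polynomial.aeval x (p.map (algebraMap D L)) = 0 := by
    rw [Polynomial.aeval_map_algebraMap]; exact hpx
  rw [h3] at h2
  by_contra hne
  have h4 : Polynomial.eval μ (p.map (algebraMap D L)) ≠ 0 := by
    rwa [Polynomial.eval_map]
  have := (spectrum.mem_iff.1 h2)
  apply this
  rw [sub_zero]
  exact (isUnit_iff_ne_zero.2 h4).map (algebraMap L _)

theorem exists_algebraMap_eq_det_and_trace [IsFractionRing D K]
    [IsIntegrallyClosed D] {n : Type*} [Fintype n]
    [DecidableEq n] {x : Matrix n n K} (hx : IsIntegral D x) :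
    (∃ d, algebraMap D K d = x.det) ∧ ∃ t, algebraMap D K t = x.trace := by
  let L := AlgebraicClosure K
  have hL : IsIntegral D ((Algebra.ofId K L).mapMatrix x) :=
    hx.map ((Algebra.ofId K L).mapMatrix.restrictScalars D)
  have hdet := Matrix.det_eq_prod_roots_charpoly ((Algebra.ofId K L).mapMatrix x)
  have htr := Matrix.trace_eq_sum_roots_charpoly ((Algebra.ofId K L).mapMatrix x)
  have e1 : ((Algebra.ofId K L).mapMatrix x).det = algebraMap K L x.det :=
    (RingHom.map_det (algebraMap K L) x).symm
  have e2 : ((Algebra.ofId K L).mapMatrix x).trace = algebraMap K L x.trace :=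
    (AddMonoidHom.map_trace (algebraMap K L) x).symm
  refine ⟨IsIntegrallyClosed.isIntegral_iff.1 ?_, IsIntegrallyClosed.isIntegral_iff.1 ?_⟩
  · refine (isIntegral_algebraMap_iff (algebraMap K L).injective).1 ?_
    rw [← e1, hdet]
    exact IsIntegral.multiset_prod fun μ hμ => isIntegral_of_mem_roots_charpoly hL hμ
  · refine (isIntegral_algebraMap_iff (algebraMap K L).injective).1 ?_
    rw [← e2, htr]
    exact IsIntegral.multiset_sum fun μ hμ => isIntegral_of_mem_roots_charpoly hL hμ

end Integrality

/-! ### Norm, trace, conjugation and the Jacobson radical of an order. -/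

section Order

variable {D K : Type*} [CommRing D] [IsDomain D] [IsDiscreteValuationRing D]
    [Field K] [Algebra D K] [IsFractionRing D K]
    {R : Subalgebra D (Matrix (Fin 2) (Fin 2) K)}

namespace IsOrder

theorem exists_trace (hR : IsOrder K R) {x : Matrix (Fin 2) (Fin 2) K} (hx : x ∈ R) :
    ∃ t, algebraMap D K t = x.trace :=
  (exists_algebraMap_eq_det_and_trace (IsIntegral.of_mem_of_fg R hR.fg x hx)).2

theorem exists_det (hR : IsOrder K R) {x : Matrix (Fin 2) (Fin 2) K} (hx : x ∈ R) :
    ∃ d, algebraMap D K d = x.det :=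
  (exists_algebraMap_eq_det_and_trace (IsIntegral.of_mem_of_fg R hR.fg x hx)).1

theorem adjugate_mem (hR : IsOrder K R) {x : Matrix (Fin 2) (Fin 2) K} (hx : x ∈ R) :
    x.adjugate ∈ R := by
  obtain ⟨t, ht⟩ := hR.exists_trace hx
  rw [adjugate_eq_trace_smul_sub, ← ht, algebraMap_smul]
  exact R.sub_mem (R.smul_mem R.one_mem t) hx

/-- The reduced norm of an order, with values in the discrete valuation ring. -/
noncomputable def norm (hR : IsOrder K R) : R →* D where
  toFun x := (hR.exists_det x.2).choose
  map_one' := IsFractionRing.injective D K (by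
    rw [(hR.exists_det (1 : R).2).choose_spec]; simp)
  map_mul' x y := IsFractionRing.injective D K (by
    rw [(hR.exists_det (x * y).2).choose_spec, map_mul, (hR.exists_det x.2).choose_spec,
      (hR.exists_det y.2).choose_spec]
    simp)

theorem algebraMap_norm (hR : IsOrder K R) (x : R) :
    algebraMap D K (hR.norm x) = (x : Matrix (Fin 2) (Fin 2) K).det :=
  (hR.exists_det x.2).choose_spec

/-- The reduced trace of an order, with values in the discrete valuation ring. -/
noncomputable def tr (hR : IsOrder K R) : R →ₗ[D] D where
  toFun x := (hR.exists_trace x.2).choose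
  map_add' x y := IsFractionRing.injective D K (by
    rw [(hR.exists_trace (x + y).2).choose_spec, map_add, (hR.exists_trace x.2).choose_spec,
      (hR.exists_trace y.2).choose_spec]
    simp)
  map_smul' d x := IsFractionRing.injective D K (by
    rw [(hR.exists_trace (d • x).2).choose_spec, RingHom.id_apply, smul_eq_mul, map_mul,
      (hR.exists_trace x.2).choose_spec]
    rw [R.coe_smul, Matrix.trace_smul, Algebra.smul_def])

theorem algebraMap_tr (hR : IsOrder K R) (x : R) :
    algebraMap D K (hR.tr x) = (x : Matrix (Fin 2) (Fin 2) K).trace :=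
  (hR.exists_trace x.2).choose_spec

theorem tr_one (hR : IsOrder K R) : hR.tr 1 = 2 :=
  IsFractionRing.injective D K (by
    rw [hR.algebraMap_tr, map_ofNat]; simp)

theorem norm_smul (hR : IsOrder K R) (d : D) (x : R) : hR.norm (d • x) = d ^ 2 * hR.norm x :=
  IsFractionRing.injective D K (by
    rw [hR.algebraMap_norm, map_mul, hR.algebraMap_norm, R.coe_smul, ← algebraMap_smul K d,
      Matrix.det_smul]
    simp)

theorem norm_add (hR : IsOrder K R) (x y : R) :
    hR.norm (x + y) = hR.norm x + (hR.tr x * hR.tr y - hR.tr (x * y)) + hR.norm y :=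
  IsFractionRing.injective D K (by
    simp only [map_add, map_sub, map_mul, hR.algebraMap_norm, hR.algebraMap_tr]
    exact det_add_fin_two _ _)

theorem mul_self (hR : IsOrder K R) (x : R) : x * x = hR.tr x • x - hR.norm x • 1 := by
  apply Subtype.ext
  have := mul_self_fin_two (x : Matrix (Fin 2) (Fin 2) K)
  rw [← hR.algebraMap_norm, ← hR.algebraMap_tr, algebraMap_smul, algebraMap_smul] at this
  simpa using this

/-- The conjugate of an element of an order. -/
noncomputable def conj (hR : IsOrder K R) (x : R) : R :=
  ⟨(x : Matrix (Fin 2) (Fin 2) K).adjugate, hR.adjugate_mem x.2⟩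

theorem mul_conj (hR : IsOrder K R) (x : R) : x * hR.conj x = hR.norm x • 1 := by
  apply Subtype.ext
  have := Matrix.mul_adjugate (x : Matrix (Fin 2) (Fin 2) K)
  rw [← hR.algebraMap_norm, algebraMap_smul] at this
  simpa [conj] using this

theorem conj_mul (hR : IsOrder K R) (x : R) : hR.conj x * x = hR.norm x • 1 := by
  apply Subtype.ext
  have := Matrix.adjugate_mul (x : Matrix (Fin 2) (Fin 2) K)
  rw [← hR.algebraMap_norm, algebraMap_smul] at this
  simpa [conj] using this

theorem norm_conj (hR : IsOrder K R) (x : R) : hR.norm (hR.conj x) = hR.norm x :=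
  IsFractionRing.injective D K (by
    rw [hR.algebraMap_norm, hR.algebraMap_norm]; simp [conj, Matrix.det_adjugate])

theorem conj_mul_rev (hR : IsOrder K R) (x y : R) : hR.conj (x * y) = hR.conj y * hR.conj x :=
  Subtype.ext (by simp [conj, Matrix.adjugate_mul_distrib])

theorem conj_conj (hR : IsOrder K R) (x : R) : hR.conj (hR.conj x) = x :=
  Subtype.ext (by
    ext i j
    fin_cases i <;> fin_cases j <;> simp [conj, Matrix.adjugate_fin_two])

theorem tr_mul_conj (hR : IsOrder K R) (x y : R) :
    hR.tr (x * hR.conj y) = hR.tr x * hR.tr y - hR.tr (x * y) :=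
  IsFractionRing.injective D K (by
    simp only [map_sub, map_mul, hR.algebraMap_tr]
    exact trace_mul_adjugate_fin_two _ _)

theorem isUnit_iff (hR : IsOrder K R) {x : R} : IsUnit x ↔ IsUnit (hR.norm x) := by
  refine ⟨fun h => h.map _, fun h => ?_⟩
  obtain ⟨d, hd⟩ := h.exists_left_inv
  refine ⟨⟨x, d • hR.conj x, ?_, ?_⟩, rfl⟩
  · rw [mul_smul_comm, hR.mul_conj, smul_smul, hd, one_smul]
  · rw [smul_mul_assoc, hR.conj_mul, smul_smul, hd, one_smul]

theorem norm_mem_iff (hR : IsOrder K R) {x : R} : hR.norm x ∈ maximalIdeal D ↔ ¬ IsUnit x := by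
  rw [hR.isUnit_iff, IsLocalRing.mem_maximalIdeal, mem_nonunits_iff]

theorem exists_smul_mem (hR : IsOrder K R) (x : Matrix (Fin 2) (Fin 2) K) :
    ∃ d : D, d ≠ 0 ∧ d • x ∈ R := by
  have hx : x ∈ Submodule.span K (R : Set (Matrix (Fin 2) (Fin 2) K)) := by
    rw [hR.span_eq_top]; trivial
  induction hx using Submodule.span_induction with
  | mem x h => exact ⟨1, one_ne_zero, by rwa [one_smul]⟩
  | zero => exact ⟨1, one_ne_zero, by rw [smul_zero]; exact R.zero_mem⟩
  | add x y _ _ hx hy =>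
    obtain ⟨a, ha, hx⟩ := hx
    obtain ⟨b, hb, hy⟩ := hy
    refine ⟨a * b, mul_ne_zero ha hb, ?_⟩
    rw [smul_add]
    refine R.add_mem ?_ ?_
    · rw [mul_comm, mul_smul]; exact R.smul_mem hx b
    · rw [mul_smul]; exact R.smul_mem hy a
  | smul k x _ hx =>
    obtain ⟨a, ha, hx⟩ := hx
    obtain ⟨c, b, hb, rfl⟩ := IsFractionRing.div_surjective (A := D) k
    have hb0 : b ≠ 0 := nonZeroDivisors.ne_zero hb
    refine ⟨b * a, mul_ne_zero hb0 ha, ?_⟩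
    have hbK : algebraMap D K b ≠ 0 := by simpa using hb0
    have : (b * a) • (algebraMap D K c / algebraMap D K b) • x = c • a • x := by
      rw [← algebraMap_smul K (b * a), ← algebraMap_smul K c, ← algebraMap_smul K a x, smul_smul,
        smul_smul, map_mul]
      congr 1
      field_simp
    rw [this]
    exact R.smul_mem hx c

/-- The elements of the Jacobson radical of an order. -/
theorem mem_jacobson_iff (hR : IsOrder K R) {x : R} :
    x ∈ Ring.jacobson R ↔ ¬ IsUnit x ∧ ∀ y, hR.tr (y * x) ∈ maximalIdeal D := by
  rw [← Ideal.jacobson_bot, Ideal.mem_jacobson_iff]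
  simp only [Ideal.mem_bot]
  -- This expansion drives both directions, since an element is a unit exactly when its norm is.
  have key : ∀ y, hR.norm (1 + y * x) = 1 + hR.tr (y * x) + hR.norm (y * x) := fun y => by
    rw [hR.norm_add, hR.tr_one, one_mul, map_one]; ring
  constructor
  · intro h
    have hx : ¬ IsUnit x := fun hx => by
      obtain ⟨v, hv⟩ := hx.exists_left_inv
      obtain ⟨z, hz⟩ := h (-v)
      have h1 : z * -v * x = -z := by
        rw [mul_neg z v, neg_mul (z * v) x, mul_assoc, hv, mul_one]
      rw [h1] at hz
      simp at hz
    refine ⟨hx, fun y => ?_⟩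
    by_contra hy
    rw [IsLocalRing.mem_maximalIdeal, mem_nonunits_iff, not_not] at hy
    obtain ⟨d, hd⟩ := hy.exists_left_inv
    -- The scaling makes the trace of `(-d • y) * x` equal to `-1`, so `1 + (-d • y) * x` has the
    -- norm of `(-d • y) * x`. Left invertibility of the former makes `x` a unit.
    obtain ⟨z, hz⟩ := h (-d • y)
    have hz' : z * (1 + (-d • y) * x) = 1 := by
      rw [← sub_eq_zero, ← hz]; noncomm_ring
    have hn := congrArg hR.norm hz'
    rw [map_mul, map_one, key, smul_mul_assoc, map_smul, smul_eq_mul, neg_mul, hd] at hn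
    have hu : IsUnit (hR.norm ((-d • (y * x)))) := by
      rw [add_neg_cancel, zero_add] at hn
      exact IsUnit.of_mul_eq_one_right _ hn
    rw [← smul_mul_assoc, map_mul] at hu
    exact hx (hR.isUnit_iff.2 (isUnit_of_mul_isUnit_right hu))
  · rintro ⟨hx, h⟩ y
    have hu : IsUnit (1 + y * x) := by
      rw [hR.isUnit_iff, key, add_assoc]
      have hm : hR.tr (y * x) + hR.norm (y * x) ∈ maximalIdeal D := by
        refine Ideal.add_mem _ (h y) ?_
        rw [map_mul]
        exact Ideal.mul_mem_left _ _ (hR.norm_mem_iff.2 hx)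
      exact isUnit_one_add_of_mem_maximalIdeal hm
    obtain ⟨z, hz⟩ := hu.exists_left_inv
    refine ⟨z, ?_⟩
    rw [sub_eq_zero, ← hz]; noncomm_ring

theorem smul_mem_jacobson (hR : IsOrder K R) {d : D} (hd : d ∈ maximalIdeal D) (x : R) :
    d • x ∈ Ring.jacobson R := by
  refine hR.mem_jacobson_iff.2 ⟨hR.norm_mem_iff.1 ?_, fun y => ?_⟩
  · rw [hR.norm_smul]
    exact Ideal.mul_mem_right _ _ (Ideal.pow_mem_of_mem _ hd 2 two_pos)
  · rw [mul_smul_comm, map_smul]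
    exact Ideal.mul_mem_right _ _ hd

end IsOrder

end Order

/-! ### The normalized valuation on powers of a uniformizer. -/

section Valuation

variable {D K : Type*} [CommRing D] [IsDomain D] [IsDiscreteValuationRing D]
    [Field K] [Algebra D K] [IsFractionRing D K]

theorem sv_algebraMap_of_associated {d ϖ : D} (hϖ : Irreducible ϖ) {n : ℕ}
    (h : Associated d (ϖ ^ n)) : sv D (algebraMap D K d) = ((n : ℤ) : WithTop ℤ) := by
  have hd : d ≠ 0 := fun h0 => pow_ne_zero n hϖ.ne_zero ((h.eq_zero_iff).1 h0)
  have hval : (IsDiscreteValuationRing.maximalIdeal D).intValuation ϖ = WithZero.exp (-1) :=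
    IsDedekindDomain.HeightOneSpectrum.intValuation_singleton _ hϖ.ne_zero
      ((IsDiscreteValuationRing.irreducible_iff_uniformizer ϖ).1 hϖ)
  obtain ⟨u, hu⟩ := h
  have hunit : (IsDiscreteValuationRing.maximalIdeal D).intValuation (u : D) = 1 := by
    refine IsDedekindDomain.HeightOneSpectrum.intValuation_eq_one_iff.2 fun hmem => ?_
    exact (IsLocalRing.mem_maximalIdeal _).1 hmem u.isUnit
  have hvd : (IsDiscreteValuationRing.maximalIdeal D).intValuation d = WithZero.exp (-1) ^ n := by
    rw [← hval, ← map_pow, ← hu, map_mul, hunit, mul_one]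
  rw [sv, if_neg (by simpa using hd), IsDedekindDomain.HeightOneSpectrum.valuation_of_algebraMap,
    hvd, WithZero.log_pow, WithZero.log_exp]
  simp

end Valuation

theorem ideal_sq_eq_mul {S : Type*} [Ring S] (I : Ideal S) : I ^ 2 = I * I := by
  rw [Submodule.pow_succ, Submodule.pow_one]

/-! ### Atoms of prescribed norm and infinite elasticity. -/

namespace IsOrder

variable {D K : Type*} [CommRing D] [IsDomain D] [IsDiscreteValuationRing D]
    [Field K] [Algebra D K] [IsFractionRing D K]
    {R : Subalgebra D (Matrix (Fin 2) (Fin 2) K)}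

theorem mem_nonZeroDivisors_iff (hR : IsOrder K R) {x : R} : x ∈ R⁰ ↔ hR.norm x ≠ 0 := by
  constructor
  · intro hx h0
    have h1 := hR.mul_conj x
    rw [h0, zero_smul] at h1
    have h2 := (_root_.mem_nonZeroDivisors_iff.1 hx).1 _ h1
    have h3 : x = 0 := by
      rw [← hR.conj_conj x, h2]
      exact Subtype.ext (by simp [conj])
    rw [h3] at hx
    exact zero_notMem_nonZeroDivisors hx
  · intro hx
    have key : ∀ y : R, hR.norm x • y = 0 → y = 0 := fun y hy => by
      apply Subtype.ext
      have h1 : algebraMap D K (hR.norm x) • (y : Matrix (Fin 2) (Fin 2) K) = 0 := by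
        rw [algebraMap_smul]; exact congrArg Subtype.val hy
      exact (smul_eq_zero.1 h1).resolve_left (by simpa using hx)
    refine _root_.mem_nonZeroDivisors_iff.2 ⟨fun y hy => key y ?_, fun y hy => key y ?_⟩
    · rw [← one_mul y, ← smul_mul_assoc, ← hR.conj_mul, mul_assoc, hy, mul_zero]
    · rw [← mul_one y, ← mul_smul_comm, ← hR.mul_conj, ← mul_assoc, hy, zero_mul]

theorem isUnit_coe_iff (hR : IsOrder K R) {x : R⁰} : IsUnit x ↔ IsUnit (x : R) := by
  refine ⟨fun h => h.map R⁰.subtype, fun h => ?_⟩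
  obtain ⟨u, hu⟩ := h
  have hv : (u⁻¹).val ∈ R⁰ :=
    hR.mem_nonZeroDivisors_iff.2 ((u⁻¹).isUnit.map hR.norm).ne_zero
  refine ⟨⟨x, ⟨(u⁻¹).val, hv⟩, Subtype.ext ?_, Subtype.ext ?_⟩, rfl⟩
  · change (x : R) * (u⁻¹).val = 1
    rw [← hu]; exact u.mul_inv
  · change (u⁻¹).val * (x : R) = 1
    rw [← hu]; exact u.inv_mul

/-- The trace form is non-degenerate: a matrix unit detects any given nonzero entry, and a multiple
of it lies in `R`. -/
theorem exists_tr_mul_ne_zero (hR : IsOrder K R) {z : R} (hz : z ≠ 0) :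
    ∃ y, hR.tr (z * y) ≠ 0 := by
  have hz' : (z : Matrix (Fin 2) (Fin 2) K) ≠ 0 := fun h => hz (Subtype.ext h)
  obtain ⟨i, j, hij⟩ : ∃ i j, (z : Matrix (Fin 2) (Fin 2) K) i j ≠ 0 := by
    by_contra! h
    exact hz' (Matrix.ext h)
  obtain ⟨d, hd, hy⟩ := hR.exists_smul_mem (Matrix.single j i 1)
  refine ⟨⟨_, hy⟩, fun h => ?_⟩
  have h1 := hR.algebraMap_tr (z * ⟨_, hy⟩)
  rw [h, map_zero, R.coe_mul, mul_smul_comm, Matrix.trace_smul, Matrix.trace_mul_single, Algebra.smul_def] at h1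
  simp_all

/-- If all non-units lie in the radical, non-units outside the square of the radical are atoms. -/
theorem irreducible_of_notMem_sq (hR : IsOrder K R)
    (hloc : ∀ x : R, ¬ IsUnit x → x ∈ Ring.jacobson R) {u : R⁰} (hu : ¬ IsUnit (u : R))
    (hu2 : (u : R) ∉ Ring.jacobson R ^ 2) : Irreducible u := by
  refine ⟨fun h => hu (hR.isUnit_coe_iff.1 h), fun a b hab => ?_⟩
  by_contra! h
  apply hu2
  rw [hab, ideal_sq_eq_mul]
  exact Ideal.mul_mem_mul (hloc _ fun h' => h.1 (hR.isUnit_coe_iff.2 h'))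
    (hloc _ fun h' => h.2 (hR.isUnit_coe_iff.2 h'))

/-- The atoms are `z + w` with `w` a highly divisible multiple of the conjugate of `y`, where `tr (z
y) ≠ 0`. As `nr z = 0`, the cross term, linear in `w`, dominates the quadratic term `nr w`. -/
theorem exists_irreducible_norm (hR : IsOrder K R)
    (hloc : ∀ x : R, ¬ IsUnit x → x ∈ Ring.jacobson R) {z : R}
    (hz2 : z ∉ Ring.jacobson R ^ 2) (hz0 : hR.norm z = 0) {ϖ : D} (hϖ : Irreducible ϖ) :
    ∃ N : ℕ, ∀ n, N ≤ n → ∃ u : R⁰, Irreducible u ∧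
      Associated (hR.norm u) (ϖ ^ (2 * n)) := by
  have hϖm : ϖ ∈ maximalIdeal D := hϖ.not_isUnit
  obtain ⟨y, hy⟩ := hR.exists_tr_mul_ne_zero (z := z) (fun h => hz2 (h ▸ Ideal.zero_mem _))
  obtain ⟨c, ε, hε⟩ := IsDiscreteValuationRing.associated_pow_irreducible hy hϖ
  -- The polar form of the norm at `z` and the conjugate of `y` is `tr (z y)`.
  have hb : hR.tr z * hR.tr (hR.conj y) - hR.tr (z * hR.conj y) = hR.tr (z * y) := by
    have h1 := hR.tr_mul_conj 1 y
    rw [one_mul, one_mul, hR.tr_one] at h1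
    rw [h1, hR.tr_mul_conj]; ring
  refine ⟨c + 2, fun n hn => ?_⟩
  -- Here `c` is the valuation of `tr (z y)`. The remaining exponent `c + 2 + k` goes into `w`;
  -- being at least 2 it puts `w` in `J²`, and exceeding `c` it makes `nr w` negligible.
  obtain ⟨k, hk⟩ : ∃ k, 2 * n = c + (c + 2 + k) := ⟨2 * n - (c + (c + 2)), by omega⟩
  let w : R := ϖ ^ (c + 2 + k) • hR.conj y
  have hw : w ∈ Ring.jacobson R ^ 2 := by
    have h1 : w = ((ϖ • (1 : R)) * (ϖ ^ (c + 1 + k) • hR.conj y)) := by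
      rw [smul_mul_smul_comm, one_mul, ← pow_succ']
      have h2 : c + 2 + k = c + 1 + k + 1 := by ring
      rw [← h2]
    rw [h1, ideal_sq_eq_mul]
    refine Ideal.mul_mem_mul (hR.smul_mem_jacobson hϖm _) (hR.smul_mem_jacobson ?_ _)
    exact Ideal.pow_mem_of_mem _ hϖm _ (by omega)
  have hnorm : hR.norm (z + w) * (ε : D) = ϖ ^ (2 * n) * (1 + ϖ * (ϖ ^ (k + 1) * hR.norm y * ε)) := by
    rw [hR.norm_add, hz0, hR.norm_smul, map_smul, (mul_smul_comm _ _ _ : z * w = _),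
      map_smul, hR.norm_conj, hk]
    simp only [smul_eq_mul]
    have : hR.tr z * (ϖ ^ (c + 2 + k) * hR.tr (hR.conj y)) -
        ϖ ^ (c + 2 + k) * hR.tr (z * hR.conj y) = ϖ ^ (c + 2 + k) * hR.tr (z * y) := by
      rw [← hb]; ring
    rw [this, zero_add, add_mul, mul_assoc _ _ (ε : D), hε]
    ring
  have hunit : IsUnit (1 + ϖ * (ϖ ^ (k + 1) * hR.norm y * ε)) :=
    isUnit_one_add_of_mem_maximalIdeal (Ideal.mul_mem_right _ _ hϖm)
  have hassoc : Associated (hR.norm (z + w)) (ϖ ^ (2 * n)) := by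
    refine (associated_mul_unit_right (hR.norm (z + w)) ε ε.isUnit).trans ?_
    rw [hnorm]
    exact associated_mul_unit_left _ _ hunit
  have hne : hR.norm (z + w) ≠ 0 := fun h0 =>
    pow_ne_zero (2 * n) hϖ.ne_zero ((hassoc.eq_zero_iff).1 h0)
  refine ⟨⟨z + w, hR.mem_nonZeroDivisors_iff.2 hne⟩, hR.irreducible_of_notMem_sq hloc ?_ ?_, hassoc⟩
  · rw [← hR.norm_mem_iff, Ideal.mem_iff_of_associated hassoc]
    exact Ideal.pow_mem_of_mem _ hϖm _ (by omega)
  · intro h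
    exact hz2 ((Submodule.add_mem_iff_left _ hw).1 h)

/-- Every non-unit of the cancellative monoid of an order is a product of atoms. -/
theorem exists_factorization (hR : IsOrder K R) (a : R⁰) (ha : ¬ IsUnit a) :
    ∃ l : List R⁰, (∀ u ∈ l, Irreducible u) ∧ l ≠ [] ∧ a = l.prod := by
  induction h : hR.norm a using
    (wellFounded_dvdNotUnit (α := D)).induction generalizing a with
  | _ d ih =>
  subst h
  by_cases hirr : Irreducible a
  · exact ⟨[a], by simpa using hirr, by simp, by simp⟩
  · obtain ⟨b, c, hbc, hb, hc⟩ : ∃ b c, a = b * c ∧ ¬ IsUnit b ∧ ¬ IsUnit c := by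
      by_contra! hno
      exact hirr ⟨ha, fun b c hbc => or_iff_not_imp_left.2 fun hb => hno b c hbc hb⟩
    have hmul : hR.norm a = hR.norm b * hR.norm c := by rw [hbc, ← map_mul]; rfl
    have hb0 := hR.mem_nonZeroDivisors_iff.1 b.2
    have hc0 := hR.mem_nonZeroDivisors_iff.1 c.2
    have hbu : ¬ IsUnit (hR.norm b) := by rwa [← hR.isUnit_iff, ← hR.isUnit_coe_iff]
    have hcu : ¬ IsUnit (hR.norm c) := by rwa [← hR.isUnit_iff, ← hR.isUnit_coe_iff]
    obtain ⟨l₁, h₁, hn, rfl⟩ := ih _ ⟨hb0, _, hcu, hmul⟩ b hb rfl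
    obtain ⟨l₂, h₂, -, rfl⟩ := ih _ ⟨hc0, _, hbu, hmul.trans (mul_comm _ _)⟩ c hc rfl
    refine ⟨l₁ ++ l₂, fun u hu => ?_, by simp [hn], by simp [hbc]⟩
    exact (List.mem_append.1 hu).elim (h₁ u) (h₂ u)

/-- A product of `n` non-units has a factorization into at least `n` atoms. -/
theorem exists_mem_lengthSet_pow (hR : IsOrder K R) {a : R⁰} (ha : ¬ IsUnit a) (ε : (R⁰)ˣ) (n : ℕ) :
    ∃ k, n ≤ k ∧ k ∈ lengthSet (ε * a ^ n) := by
  obtain ⟨l, hl, hne, rfl⟩ := hR.exists_factorization a ha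
  refine ⟨n * l.length, Nat.le_mul_of_pos_right _ (List.length_pos_iff.2 hne), ε,
    (List.replicate n l).flatten, fun u hu => ?_, by simp, by simp⟩
  obtain ⟨m, hm, hu⟩ := List.mem_flatten.1 hu
  exact hl u ((List.mem_replicate.1 hm).2 ▸ hu)

theorem irreducible_conj (hR : IsOrder K R) {u v : R⁰} (hu : Irreducible u)
    (hv : (v : R) = hR.conj u) : Irreducible v := by
  have hunit : ∀ {a b : R⁰}, (b : R) = hR.conj a → IsUnit b → IsUnit a := fun hab hb => by
    rw [hR.isUnit_coe_iff, hR.isUnit_iff] at hb ⊢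
    rwa [hab, hR.norm_conj] at hb
  have hex : ∀ a : R⁰, ∃ b : R⁰, (b : R) = hR.conj a := fun a =>
    ⟨⟨hR.conj a, hR.mem_nonZeroDivisors_iff.2
      (by rw [hR.norm_conj]; exact hR.mem_nonZeroDivisors_iff.1 a.2)⟩, rfl⟩
  refine ⟨fun h => hu.not_isUnit (hunit hv h), fun a b hab => ?_⟩
  obtain ⟨a', ha'⟩ := hex a
  obtain ⟨b', hb'⟩ := hex b
  have : u = b' * a' := Subtype.ext (by
    rw [Submonoid.coe_mul, ha', hb', ← hR.conj_mul_rev, ← Submonoid.coe_mul, ← hab, hv,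
      hR.conj_conj])
  exact (hu.isUnit_or_isUnit this).symm.imp (hunit ha') (hunit hb')

theorem elasticity_eq_top (hR : IsOrder K R) {ϖ : D} (hϖ : Irreducible ϖ) {N : ℕ}
    (h : ∀ n, N ≤ n → ∃ u : R⁰, Irreducible u ∧ Associated (hR.norm u) (ϖ ^ (2 * n))) :
    elasticity R⁰ = ⊤ := by
  refine ENNReal.eq_top_of_forall_nnreal_le fun r => ?_
  obtain ⟨n, hn⟩ := exists_nat_ge r
  obtain ⟨u, hu, hun⟩ := h (max N n) (le_max_left _ _)
  have hn' : r ≤ (max N n : ℕ) := hn.trans (by exact_mod_cast le_max_right N n)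
  generalize max N n = m at hun hn'
  obtain ⟨ε, hε⟩ := hun.symm
  have hscal : ∀ d : D, hR.norm (d • 1) = d ^ 2 := fun d => by
    rw [hR.norm_smul, map_one, mul_one]
  let p : R⁰ := ⟨ϖ • 1, hR.mem_nonZeroDivisors_iff.2
    (by rw [hscal]; exact pow_ne_zero 2 hϖ.ne_zero)⟩
  let v : R⁰ := ⟨hR.conj u, hR.mem_nonZeroDivisors_iff.2
    (by rw [hR.norm_conj]; exact hR.mem_nonZeroDivisors_iff.1 u.2)⟩
  have hv : Irreducible v := hR.irreducible_conj hu rfl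
  have hp : ¬ IsUnit p := by
    rw [hR.isUnit_coe_iff, hR.isUnit_iff, hscal, isUnit_pow_iff two_ne_zero]
    exact hϖ.not_isUnit
  let e : R⁰ := ⟨(ε : D) • 1, hR.mem_nonZeroDivisors_iff.2
    (by rw [hscal]; exact pow_ne_zero 2 ε.ne_zero)⟩
  obtain ⟨e', he'⟩ : IsUnit e := by
    rw [hR.isUnit_coe_iff, hR.isUnit_iff, hscal]
    exact ε.isUnit.pow 2
  -- Two factorizations of `nr u`: two atoms on the left, `2 * m` non-units on the right.
  have huv : u * v = e' * p ^ (2 * m) := Subtype.ext (by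
    change (u : R) * hR.conj u = (e' : R⁰) * (p : R) ^ (2 * m)
    rw [hR.mul_conj, he', ← hε]
    change _ = ((ε : D) • (1 : R)) * (ϖ • (1 : R)) ^ (2 * m)
    rw [smul_pow, one_pow, smul_mul_smul_comm, one_mul, mul_comm])
  have h2 : 2 ∈ lengthSet (u * v) := ⟨1, [u, v], by simp [hu, hv], rfl, by simp⟩
  obtain ⟨k, hk, hk'⟩ := hR.exists_mem_lengthSet_pow hp e' (2 * m)
  rw [← huv] at hk'
  have hnu : ¬ IsUnit (u * v) := by
    intro hun
    rw [hR.isUnit_coe_iff, Submonoid.coe_mul] at hun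
    have := hun.map hR.norm
    rw [map_mul, IsUnit.mul_iff, ← hR.isUnit_iff, ← hR.isUnit_coe_iff] at this
    exact hu.not_isUnit this.1
  refine le_trans ?_ (le_iSup _ (u * v))
  rw [elementElasticity, if_neg hnu]
  calc (r : ℝ≥0∞) ≤ (m : ℝ≥0∞) := by exact_mod_cast hn'
    _ = ((2 * m : ℕ) : ℝ≥0∞) / (2 : ℕ) := by
      push_cast
      rw [mul_comm, ENNReal.mul_div_cancel_right two_ne_zero ENNReal.ofNat_ne_top]
    _ ≤ _ := by
      refine ENNReal.div_le_div ?_ (by exact_mod_cast Nat.sInf_le h2)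
      exact le_trans (by exact_mod_cast hk) (le_iSup₂ (f := fun k (_ : k ∈ lengthSet (u * v)) =>
        (k : ℝ≥0∞)) k hk')

end IsOrder

/-! ### Idempotents in non-local orders. -/

/-- Approximate roots of a quadratic polynomial that has a simple root modulo `I`. -/
theorem exists_mul_self_sub_mem_pow {D : Type*} [CommRing D] {I : Ideal D} {c : D} (hc : c ∈ I)
    (n : ℕ) : ∃ a ∈ I, a * a - a - c ∈ I ^ n := by
  induction n with
  | zero => exact ⟨0, I.zero_mem, by simp⟩
  | succ n ih =>
    obtain ⟨a, ha, h⟩ := ih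
    -- Fixed-point iteration for `a = a² - c`, which contracts on `I`.
    refine ⟨a * a - c, I.sub_mem (I.mul_mem_left _ ha) hc, ?_⟩
    have h1 : (a * a - c) * (a * a - c) - (a * a - c) - c =
        (a * a - a - c) * (a + (a * a - c)) := by ring
    rw [h1, pow_succ]
    exact Ideal.mul_mem_mul h (I.add_mem ha (I.sub_mem (I.mul_mem_left _ ha) hc))

/-- If the characteristic polynomial of `e` is separable, then some nilpotent matrix is not
orthogonal to `e` under the trace form. -/
theorem exists_nilpotent_trace_mul_ne_zero {K : Type*} [Field K] {e : Matrix (Fin 2) (Fin 2) K}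
    (he : e.trace * e.trace ≠ 4 * e.det) :
    ∃ w : Matrix (Fin 2) (Fin 2) K, w.trace = 0 ∧ w.det = 0 ∧ (e * w).trace ≠ 0 := by
  by_contra! h
  -- These three nilpotents span the trace-zero matrices; only scalars are orthogonal to all of
  -- them, and scalars have zero discriminant.
  have h1 := h !![0, 1; 0, 0] (by simp [Matrix.trace_fin_two]) (by simp)
  have h2 := h !![0, 0; 1, 0] (by simp [Matrix.trace_fin_two]) (by simp)
  have h3 := h !![1, -1; 1, -1] (by simp [Matrix.trace_fin_two]) (by simp)
  simp [Matrix.trace_fin_two, Matrix.mul_apply, Fin.sum_univ_two] at h1 h2 h3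
  apply he
  rw [Matrix.trace_fin_two, Matrix.det_fin_two]
  rw [h1, h2] at *
  linear_combination (e 0 0 - e 1 1) * h3

namespace IsOrder

variable {D K : Type*} [CommRing D] [IsDomain D] [IsDiscreteValuationRing D]
    [Field K] [Algebra D K] [IsFractionRing D K]
    {R : Subalgebra D (Matrix (Fin 2) (Fin 2) K)}

theorem exists_tr_eq_zero_tr_mul_ne_zero (hR : IsOrder K R) {e : R}
    (he : hR.tr e * hR.tr e ≠ 4 * hR.norm e) :
    ∃ w : R, hR.tr w = 0 ∧ hR.norm w = 0 ∧ hR.tr (e * w) ≠ 0 := by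
  have he' : (e : Matrix (Fin 2) (Fin 2) K).trace * (e : Matrix (Fin 2) (Fin 2) K).trace ≠
      4 * (e : Matrix (Fin 2) (Fin 2) K).det := fun h =>
    he (IsFractionRing.injective D K (by
      rw [map_mul, map_mul, hR.algebraMap_tr, hR.algebraMap_norm, h, map_ofNat]))
  obtain ⟨w, hw1, hw2, hw3⟩ := exists_nilpotent_trace_mul_ne_zero he'
  obtain ⟨d, hd, hdw⟩ := hR.exists_smul_mem w
  have hinj := IsFractionRing.injective D K
  refine ⟨⟨_, hdw⟩, hinj ?_, hinj ?_, fun h => ?_⟩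
  · rw [hR.algebraMap_tr, Matrix.trace_smul, hw1, smul_zero, map_zero]
  · rw [hR.algebraMap_norm]
    change (d • w).det = _
    rw [← algebraMap_smul K, Matrix.det_smul, hw2, mul_zero, map_zero]
  · have h1 := hR.algebraMap_tr (e * ⟨_, hdw⟩)
    rw [h, map_zero, R.coe_mul, mul_smul_comm, Matrix.trace_smul, Algebra.smul_def] at h1
    simp_all

/-- An order which is not local contains a non-trivial idempotent. -/
theorem exists_tr_eq_one_norm_eq_zero (hR : IsOrder K R) {x : R} (hx : ¬ IsUnit x)
    (hxJ : x ∉ Ring.jacobson R) : ∃ e : R, hR.tr e = 1 ∧ hR.norm e = 0 := by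
  obtain ⟨y, hy⟩ : ∃ y, hR.tr (y * x) ∉ maximalIdeal D := by
    by_contra! h
    exact hxJ (hR.mem_jacobson_iff.2 ⟨hx, h⟩)
  rw [IsLocalRing.mem_maximalIdeal, mem_nonunits_iff, not_not] at hy
  obtain ⟨t, ht⟩ := hy.exists_left_inv
  obtain ⟨e, he, hδ⟩ : ∃ e : R, hR.tr e = 1 ∧ hR.norm e ∈ maximalIdeal D := by
    refine ⟨t • (y * x), by rw [map_smul, smul_eq_mul, ht], ?_⟩
    rw [hR.norm_smul, map_mul]
    exact Ideal.mul_mem_left _ _ (Ideal.mul_mem_left _ _ (hR.norm_mem_iff.2 hx))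
  have hu : IsUnit (1 - 4 * hR.norm e) := by
    rw [sub_eq_add_neg]
    exact isUnit_one_add_of_mem_maximalIdeal (neg_mem (Ideal.mul_mem_left _ _ hδ))
  obtain ⟨w, hw1, hw2, hw3⟩ := hR.exists_tr_eq_zero_tr_mul_ne_zero (e := e) (by
    rw [he, mul_one, ne_eq, ← sub_eq_zero]; exact hu.ne_zero)
  obtain ⟨ϖ, hϖ⟩ := IsDiscreteValuationRing.exists_irreducible D
  obtain ⟨n, hn⟩ := IsDiscreteValuationRing.associated_pow_irreducible hw3 hϖ
  obtain ⟨v, hv⟩ := hu.exists_left_inv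
  obtain ⟨a, ha, hroot⟩ := exists_mul_self_sub_mem_pow
    (Ideal.mul_mem_left _ v hδ : v * hR.norm e ∈ maximalIdeal D) n
  rw [hϖ.maximalIdeal_eq, Ideal.span_singleton_pow, Ideal.mem_span_singleton] at hroot
  obtain ⟨q, hq⟩ := hn.dvd.trans hroot
  have hb : IsUnit (1 - 2 * a) := by
    rw [sub_eq_add_neg]
    exact isUnit_one_add_of_mem_maximalIdeal (neg_mem (Ideal.mul_mem_left _ _ ha))
  obtain ⟨b, hb⟩ := hb.exists_left_inv
  -- These elements all have trace 1. `D` need not be complete, so `a` makes the norm only divisible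
  -- by `tr (e w)`; the norm is affine in `s` because `w` is nilpotent, so a choice of `s` removes
  -- the rest exactly.
  have hnorm : ∀ s : D, hR.norm (a • 1 + ((1 - 2 * a) • e + s • w)) =
      - (1 - 4 * hR.norm e) * (a * a - a - v * hR.norm e) - s * (1 - 2 * a) * hR.tr (e * w) := by
    intro s
    have h1 : (a • (1 : R)) * ((1 - 2 * a) • e + s • w) = a • ((1 - 2 * a) • e + s • w) := by
      rw [smul_mul_assoc, one_mul]
    have h2 : ((1 - 2 * a) • e) * (s • w) = ((1 - 2 * a) * s) • (e * w) :=
      smul_mul_smul_comm _ _ _ _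
    rw [hR.norm_add, hR.norm_add, h1, h2]
    simp only [map_add, map_smul, hR.norm_smul, map_one, hR.tr_one, he, hw1, hw2, smul_eq_mul]
    linear_combination (-hR.norm e) * hv
  refine ⟨a • 1 + ((1 - 2 * a) • e + (-(1 - 4 * hR.norm e) * q * b) • w), ?_, ?_⟩
  · simp only [map_add, map_smul, hR.tr_one, he, hw1, smul_eq_mul]
    ring
  · rw [hnorm, hq]
    linear_combination (1 - 4 * hR.norm e) * q * hR.tr (e * w) * hb

end IsOrder

/-! ### Conjugates of the standard maximal order. -/

section MatrixOrder

variable {D K : Type*} [CommRing D] [Field K] [Algebra D K] {n : Type*} [Fintype n] [DecidableEq n]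

variable (D) in
/-- The conjugate `u Mₙ(D) u⁻¹` of the standard order in `Mₙ(K)`. -/
noncomputable def matrixOrder (u : (Matrix n n K)ˣ) : Subalgebra D (Matrix n n K) :=
  (Algebra.ofId D K).mapMatrix.range.map
    (MulSemiringAction.toAlgEquiv D (Matrix n n K) (ConjAct.toConjAct u)).toAlgHom

theorem mem_matrixOrder {u : (Matrix n n K)ˣ} {x : Matrix n n K} :
    x ∈ matrixOrder D u ↔ ∀ i j, ∃ d, algebraMap D K d = ((u⁻¹).val * x * u.val) i j := by
  constructor
  · rintro ⟨_, ⟨y, rfl⟩, rfl⟩ i j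
    refine ⟨y i j, ?_⟩
    simp [ConjAct.units_smul_def, mul_assoc, Algebra.ofId_apply]
  · intro h
    choose y hy using h
    refine ⟨_, ⟨Matrix.of y, rfl⟩, ?_⟩
    have : (Algebra.ofId D K).mapMatrix (Matrix.of y) = (u⁻¹).val * x * u.val := by
      ext i j
      simp [Algebra.ofId_apply, hy]
    change ConjAct.toConjAct u • (Algebra.ofId D K).mapMatrix (Matrix.of y) = x
    rw [this, ConjAct.units_smul_def]
    simp [← mul_assoc]

theorem conj_single_mem_matrixOrder (u : (Matrix n n K)ˣ) (i j : n) :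
    u.val * Matrix.single i j 1 * (u⁻¹).val ∈ matrixOrder D u := by
  rw [mem_matrixOrder]
  intro a b
  have : (u⁻¹).val * (u.val * Matrix.single i j 1 * (u⁻¹).val) * u.val =
      (Matrix.single i j 1 : Matrix n n K) := by
    simp [mul_assoc]
  rw [this, Matrix.single_apply]
  split_ifs
  · exact ⟨1, map_one _⟩
  · exact ⟨0, map_zero _⟩

theorem isOrder_matrixOrder (u : (Matrix n n K)ˣ) : IsOrder K (matrixOrder D u) where
  fg := by
    refine Submodule.FG.map (MulSemiringAction.toAlgEquiv D (Matrix n n K)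
      (ConjAct.toConjAct u)).toLinearMap (N := Subalgebra.toSubmodule
        ((Algebra.ofId D K).mapMatrix (m := n)).range) ?_
    change (LinearMap.range ((Algebra.ofId D K).mapMatrix (m := n)).toLinearMap).FG
    rw [LinearMap.range_eq_map]
    exact Module.Finite.fg_top.map _
  span_eq_top := by
    rw [eq_top_iff]
    intro x _
    have hx : x = ∑ i, ∑ j, ((u⁻¹).val * x * u.val) i j •
        (u.val * Matrix.single i j 1 * (u⁻¹).val) := by
      have h1 := Matrix.matrix_eq_sum_single ((u⁻¹).val * x * u.val)
      have h2 : x = u.val * ((u⁻¹).val * x * u.val) * (u⁻¹).val := by simp [mul_assoc]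
      conv_lhs => rw [h2, h1]
      simp only [Finset.mul_sum, Finset.sum_mul]
      refine Finset.sum_congr rfl fun i _ => Finset.sum_congr rfl fun j _ => ?_
      rw [← smul_mul_assoc, ← mul_smul_comm, Matrix.smul_single, smul_eq_mul, mul_one]
    rw [hx]
    exact Submodule.sum_mem _ fun i _ => Submodule.sum_mem _ fun j _ =>
      Submodule.smul_mem _ _ (Submodule.subset_span (conj_single_mem_matrixOrder u i j))

/-- Each entry of the conjugated matrix is the trace of a product with a conjugated matrix unit. In
a larger order that product is integral, so its trace is in `D`. -/
theorem isMaximalOrder_matrixOrder [IsDomain D] [IsFractionRing D K] [IsIntegrallyClosed D]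
    (u : (Matrix n n K)ˣ) : IsMaximalOrder K (matrixOrder D u) := by
  refine ⟨isOrder_matrixOrder u, fun S hS hle x hx => ?_⟩
  rw [mem_matrixOrder]
  intro i j
  have hmem := S.mul_mem hx (hle (conj_single_mem_matrixOrder u j i))
  obtain ⟨d, hd⟩ := (exists_algebraMap_eq_det_and_trace (K := K)
    (IsIntegral.of_mem_of_fg S hS.fg _ hmem)).2
  refine ⟨d, hd.trans ?_⟩
  rw [← mul_assoc, Matrix.trace_mul_comm, ← mul_assoc, ← mul_assoc, Matrix.trace_mul_single]
  simp

end MatrixOrder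

/-! ### Peirce decomposition with respect to a rank-one idempotent. -/

section Peirce

variable {K : Type*} [Field K]

/-- A matrix of trace one and determinant zero is conjugate to the first diagonal matrix unit. -/
theorem exists_conj_single_eq {e : Matrix (Fin 2) (Fin 2) K} (ht : e.trace = 1) (hd : e.det = 0) :
    ∃ u : (Matrix (Fin 2) (Fin 2) K)ˣ, e * u.val = u.val * Matrix.single 0 0 1 := by
  rw [Matrix.trace_fin_two] at ht
  rw [Matrix.det_fin_two] at hd
  have h11 : e 1 1 = 1 - e 0 0 := by rw [← ht]; ring
  rw [h11] at hd
  obtain ⟨g, hg, h⟩ : ∃ g : Matrix (Fin 2) (Fin 2) K, g.det ≠ 0 ∧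
      e * g = g * Matrix.single 0 0 1 := by
    -- In both cases the first column of `g` spans the image of `e` and the second its kernel.
    by_cases h0 : e 0 0 = 0
    · refine ⟨!![e 0 1, 1; 1, -e 1 0], ?_, ?_⟩
      · rw [h0] at hd
        have : e 0 1 * e 1 0 = 0 := by linear_combination -hd
        simp [Matrix.det_fin_two, this]
      · ext i j
        fin_cases i <;> fin_cases j <;>
          simp [Matrix.mul_apply, Fin.sum_univ_two, Matrix.single_apply, h11, h0, -mul_eq_zero]
        all_goals linear_combination (1 - e 0 0) * h0 - hd
    · refine ⟨!![e 0 0, -e 0 1; e 1 0, e 0 0], ?_, ?_⟩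
      · have : e 0 0 * e 0 0 - -e 0 1 * e 1 0 = e 0 0 := by linear_combination -hd
        rw [Matrix.det_fin_two]
        simpa using fun h => h0 (this.symm.trans (by simpa using h))
      · ext i j
        fin_cases i <;> fin_cases j <;>
          simp [Matrix.mul_apply, Fin.sum_univ_two, Matrix.single_apply, h11]
        all_goals first | ring1 | linear_combination hd | linear_combination -hd
  exact ⟨Matrix.nonsingInvUnit g (isUnit_iff_ne_zero.2 hg), h⟩

end Peirce

section Peirce

variable {D K : Type*} [CommRing D] [Field K] [Algebra D K]

/-- The invertible diagonal matrix with given diagonal entries. -/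
def diagUnit (a b : Kˣ) : (Matrix (Fin 2) (Fin 2) K)ˣ where
  val := !![a, 0; 0, b]
  inv := !![(a⁻¹).val, 0; 0, (b⁻¹).val]
  val_inv := by ext i j; fin_cases i <;> fin_cases j <;> simp
  inv_val := by ext i j; fin_cases i <;> fin_cases j <;> simp

theorem mem_matrixOrder_mul_diagUnit {u : (Matrix (Fin 2) (Fin 2) K)ˣ} {a b : Kˣ}
    {x : Matrix (Fin 2) (Fin 2) K} : x ∈ matrixOrder D (u * diagUnit a b) ↔
      ((∃ d, algebraMap D K d = ((u⁻¹).val * x * u.val) 0 0) ∧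
      ∃ d, algebraMap D K d = (a⁻¹).val * ((u⁻¹).val * x * u.val) 0 1 * b) ∧
      (∃ d, algebraMap D K d = (b⁻¹).val * ((u⁻¹).val * x * u.val) 1 0 * a) ∧
      ∃ d, algebraMap D K d = ((u⁻¹).val * x * u.val) 1 1 := by
  have h : ((u * diagUnit a b)⁻¹).val * x * (u * diagUnit a b).val =
      ((diagUnit a b)⁻¹).val * ((u⁻¹).val * x * u.val) * (diagUnit a b).val := by
    simp [mul_assoc]
  rw [mem_matrixOrder, h]
  generalize (u⁻¹).val * x * u.val = y
  have h1 : ((diagUnit a b)⁻¹).val = !![(a⁻¹).val, 0; 0, (b⁻¹).val] := rfl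
  have h2 : (diagUnit a b).val = !![a.val, 0; 0, b.val] := rfl
  have h3 : !![(a⁻¹).val, 0; 0, (b⁻¹).val] * y * !![a.val, 0; 0, b.val] =
      !![y 0 0, (a⁻¹).val * y 0 1 * b; (b⁻¹).val * y 1 0 * a, y 1 1] := by
    ext i j
    fin_cases i <;> fin_cases j <;> 
      simp [Matrix.mul_apply, Matrix.vecMul, dotProduct, Fin.sum_univ_two] <;> field_simp
  rw [h1, h2, h3]
  simp only [Fin.forall_fin_two]
  rfl

variable (D) in
/-- The embedding of `K` into `M₂(K)` at position `(i, j)`, followed by a conjugation. -/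
noncomputable def entryEmb (u : (Matrix (Fin 2) (Fin 2) K)ˣ) (i j : Fin 2) :
    K →ₗ[D] Matrix (Fin 2) (Fin 2) K where
  toFun t := u.val * Matrix.single i j t * (u⁻¹).val
  map_add' s t := by rw [Matrix.single_add, mul_add, add_mul]
  map_smul' d t := by
    rw [← Matrix.smul_single, mul_smul_comm, smul_mul_assoc, RingHom.id_apply]

theorem entryEmb_apply (u : (Matrix (Fin 2) (Fin 2) K)ˣ) (i j : Fin 2) (t : K) :
    entryEmb D u i j t = u.val * Matrix.single i j t * (u⁻¹).val := rfl

theorem inv_mul_entryEmb_mul (u : (Matrix (Fin 2) (Fin 2) K)ˣ) (i j : Fin 2) (t : K) :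
    (u⁻¹).val * entryEmb D u i j t * u.val = Matrix.single i j t := by
  simp [entryEmb_apply, mul_assoc]

theorem entryEmb_injective (u : (Matrix (Fin 2) (Fin 2) K)ˣ) (i j : Fin 2) :
    Function.Injective (entryEmb D u i j) := fun s t h => by
  have h1 := congrArg (fun x => ((u⁻¹).val * x * u.val) i j) h
  simpa only [inv_mul_entryEmb_mul, Matrix.single_apply_same] using h1

theorem sum_entryEmb (u : (Matrix (Fin 2) (Fin 2) K)ˣ) (x : Matrix (Fin 2) (Fin 2) K) :
    x = ∑ i, ∑ j, entryEmb D u i j (((u⁻¹).val * x * u.val) i j) := by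
  have h1 := Matrix.matrix_eq_sum_single ((u⁻¹).val * x * u.val)
  have h2 : x = u.val * ((u⁻¹).val * x * u.val) * (u⁻¹).val := by simp [mul_assoc]
  conv_lhs => rw [h2, h1]
  simp only [Finset.mul_sum, Finset.sum_mul, entryEmb_apply]

/-- The Peirce components of a matrix. -/
theorem entryEmb_eq_mul_mul {u : (Matrix (Fin 2) (Fin 2) K)ˣ} (i j : Fin 2)
    (x : Matrix (Fin 2) (Fin 2) K) : entryEmb D u i j (((u⁻¹).val * x * u.val) i j) =
      entryEmb D u i i 1 * x * entryEmb D u j j 1 := by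
  have h : ∀ y : Matrix (Fin 2) (Fin 2) K,
      Matrix.single i j (y i j) = Matrix.single i i 1 * y * Matrix.single j j 1 := fun y => by
    rw [Matrix.single_mul_mul_single]; simp
  rw [entryEmb_apply, h]
  simp only [entryEmb_apply, mul_assoc]

/-- Shows that diagonal entries are integral once the diagonal idempotents lie in the order. -/
theorem entry_eq_trace (u : (Matrix (Fin 2) (Fin 2) K)ˣ) (i : Fin 2)
    (x : Matrix (Fin 2) (Fin 2) K) :
    ((u⁻¹).val * x * u.val) i i = (entryEmb D u i i 1 * x).trace := by
  have h : (entryEmb D u i i 1 * x).trace =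
      (((u⁻¹).val * x * u.val) * Matrix.single i i 1).trace := by
    rw [Matrix.trace_mul_comm ((u⁻¹).val * x * u.val), entryEmb_apply, mul_assoc, mul_assoc,
      Matrix.trace_mul_comm u.val]
    simp only [mul_assoc]
  rw [h, Matrix.trace_mul_single, MulOpposite.op_one, one_smul]

/-- A product of matrices with diagonal in the ideal `I` and upper right entry in `M` has its upper
right entry in `I • M`. -/
theorem mul_apply_zero_one_mem_smul {I : Ideal D} {M : Submodule D K}
    {X Y : Matrix (Fin 2) (Fin 2) K} (hX : ∃ d ∈ I, algebraMap D K d = X 0 0) (hXM : X 0 1 ∈ M)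
    (hY : ∃ d ∈ I, algebraMap D K d = Y 1 1) (hYM : Y 0 1 ∈ M) : (X * Y) 0 1 ∈ I • M := by
  obtain ⟨d, hd, hdX⟩ := hX
  obtain ⟨d', hd', hdY⟩ := hY
  rw [Matrix.mul_apply, Fin.sum_univ_two, ← hdX, ← hdY, mul_comm (X 0 1), ← Algebra.smul_def,
    ← Algebra.smul_def]
  exact Submodule.add_mem _ (Submodule.smul_mem_smul hd hYM) (Submodule.smul_mem_smul hd' hXM)

theorem IsOrder.fg_of_le [IsNoetherianRing D] {R : Subalgebra D (Matrix (Fin 2) (Fin 2) K)}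
    (hR : IsOrder K R) {N : Submodule D (Matrix (Fin 2) (Fin 2) K)}
    (hN : N ≤ Subalgebra.toSubmodule R) : N.FG := by
  have := isNoetherian_of_fg_of_noetherian _ hR.fg
  exact (isNoetherian_submodule.1 this) N hN

theorem IsOrder.fg_comap_entryEmb [IsNoetherianRing D]
    {R : Subalgebra D (Matrix (Fin 2) (Fin 2) K)} {u : (Matrix (Fin 2) (Fin 2) K)ˣ} (hR : IsOrder K R) {N : Submodule D (Matrix (Fin 2) (Fin 2) K)}
    (hN : N ≤ Subalgebra.toSubmodule R) (i j : Fin 2) : (N.comap (entryEmb D u i j)).FG :=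
  Submodule.fg_of_fg_map_injective _ (entryEmb_injective u i j)
    (hR.fg_of_le ((Submodule.map_comap_le _ _).trans hN))

end Peirce

/-! ### Orders containing the diagonal idempotents. -/

namespace IsOrder

variable {D K : Type*} [CommRing D] [IsDomain D] [IsDiscreteValuationRing D]
    [Field K] [Algebra D K] [IsFractionRing D K]
    {R : Subalgebra D (Matrix (Fin 2) (Fin 2) K)} {u : (Matrix (Fin 2) (Fin 2) K)ˣ}

/-- The entries allowed at a fixed position form a nonzero fractional ideal of `D`, which is
principal with generator `t`. -/
theorem exists_entryEmb_mem_iff (hR : IsOrder K R) (u : (Matrix (Fin 2) (Fin 2) K)ˣ)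
    (i j : Fin 2) :
    ∃ t : Kˣ, ∀ s, entryEmb D u i j s ∈ R ↔ ∃ d, algebraMap D K d = (t⁻¹).val * s := by
  have hfg := hR.fg_comap_entryEmb (u := u) le_rfl i j
  have hprin := FractionalIdeal.isPrincipal (R := D) (K := K)
    ⟨_, FractionalIdeal.isFractional_of_fg hfg⟩
  obtain ⟨t, ht⟩ := hprin
  have hmem : ∀ s, entryEmb D u i j s ∈ R ↔ ∃ d : D, d • t = s := fun s => by
    rw [← Submodule.mem_span_singleton, ← ht]; rfl
  have ht0 : t ≠ 0 := by
    rintro rfl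
    obtain ⟨d, hd, hmem'⟩ := hR.exists_smul_mem (entryEmb D u i j 1)
    rw [← map_smul, hmem] at hmem'
    obtain ⟨_, h⟩ := hmem'
    rw [smul_zero, Algebra.smul_def, mul_one] at h
    exact hd (by simpa using h.symm)
  refine ⟨Units.mk0 t ht0, fun s => (hmem s).trans (exists_congr fun d => ?_)⟩
  rw [Algebra.smul_def, Units.val_inv_eq_inv_val, Units.val_mk0, eq_inv_mul_iff_mul_eq₀ ht0,
    mul_comm]

/-- An order with a non-trivial idempotent contains both diagonal matrix units with respect to a
suitable basis. -/
theorem exists_entryEmb_mem (hR : IsOrder K R) {e : R} (he : hR.tr e = 1) (he0 : hR.norm e = 0) :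
    ∃ u : (Matrix (Fin 2) (Fin 2) K)ˣ, ∀ i, entryEmb D u i i 1 ∈ R := by
  obtain ⟨u, hu⟩ := exists_conj_single_eq (e := (e : Matrix (Fin 2) (Fin 2) K))
    (by rw [← hR.algebraMap_tr, he, map_one]) (by rw [← hR.algebraMap_norm, he0, map_zero])
  have h0 : entryEmb D u 0 0 1 = e := by
    rw [entryEmb_apply, ← hu]; simp [mul_assoc]
  have h1 : entryEmb D u 1 1 1 = 1 - e := by
    rw [← h0, eq_sub_iff_add_eq, entryEmb_apply, entryEmb_apply, ← add_mul, ← mul_add]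
    have : Matrix.single 1 1 1 + Matrix.single 0 0 1 = (1 : Matrix (Fin 2) (Fin 2) K) := by
      ext i j; fin_cases i <;> fin_cases j <;> simp
    rw [this]; simp
  refine ⟨u, Fin.forall_fin_two.2 ⟨h0 ▸ e.2, h1 ▸ R.sub_mem R.one_mem e.2⟩⟩

/-- An order that contains both diagonal matrix units is an Eichler order. -/
theorem isEichlerOrder (hR : IsOrder K R) (hu : ∀ i, entryEmb D u i i 1 ∈ R) :
    IsEichlerOrder K R := by
  obtain ⟨s, hs⟩ := hR.exists_entryEmb_mem_iff u 0 1
  obtain ⟨t, ht⟩ := hR.exists_entryEmb_mem_iff u 1 0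
  have hst : ∃ c, algebraMap D K c = t.val * s := by
    have h1 : entryEmb D u 0 1 s * entryEmb D u 1 0 t ∈ R :=
      R.mul_mem ((hs _).2 ⟨1, by simp⟩) ((ht _).2 ⟨1, by simp⟩)
    obtain ⟨c, hc⟩ := hR.exists_trace h1
    refine ⟨c, hc.trans ?_⟩
    have h2 : entryEmb D u 0 1 s * entryEmb D u 1 0 t =
        u.val * (Matrix.single 0 1 s.val * Matrix.single 1 0 t.val) * (u⁻¹).val := by
      simp only [entryEmb_apply, mul_assoc, Units.inv_mul_cancel_left]
    rw [h2, Matrix.trace_mul_comm]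
    simp [mul_comm]
  obtain ⟨c, hc⟩ := hst
  -- In the basis given by `u` these are `[[D, sD], [s⁻¹D, D]]` and `[[D, t⁻¹D], [tD, D]]`. Since
  -- `st ∈ D`, they meet in `[[D, sD], [tD, D]]`.
  refine ⟨matrixOrder D (u * diagUnit s 1), matrixOrder D (u * diagUnit 1 t),
    isMaximalOrder_matrixOrder _, isMaximalOrder_matrixOrder _, ?_⟩
  ext x
  rw [Algebra.mem_inf, mem_matrixOrder_mul_diagUnit, mem_matrixOrder_mul_diagUnit]
  have hdiag : ∀ i d, entryEmb D u i i (algebraMap D K d) ∈ R := fun i d => by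
    rw [← mul_one (algebraMap D K d), ← Algebra.smul_def, map_smul]
    exact R.smul_mem (hu i) d
  constructor
  · intro hx
    have hent : ∀ i j, entryEmb D u i j (((u⁻¹).val * x * u.val) i j) ∈ R := fun i j => by
      rw [entryEmb_eq_mul_mul]
      exact R.mul_mem (R.mul_mem (hu i) hx) (hu j)
    have hii : ∀ i, ∃ d, algebraMap D K d = ((u⁻¹).val * x * u.val) i i := fun i => by
      rw [entry_eq_trace (D := D)]
      exact hR.exists_trace (R.mul_mem (hu i) hx)
    obtain ⟨p, hp⟩ := (hs _).1 (hent 0 1)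
    obtain ⟨q, hq⟩ := (ht _).1 (hent 1 0)
    refine ⟨⟨⟨hii 0, p, by simp [hp]⟩, ⟨c * q, ?_⟩, hii 1⟩,
      ⟨hii 0, c * p, ?_⟩, ⟨q, by simp [hq]⟩, hii 1⟩
    · rw [map_mul, hc, hq]; simp; field_simp
    · rw [map_mul, hc, hp]; simp; field_simp
  · rintro ⟨⟨⟨⟨d0, h0⟩, ⟨d1, h1⟩⟩, -, ⟨d3, h3⟩⟩, -, ⟨d2, h2⟩, -⟩
    rw [sum_entryEmb (D := D) u x]
    simp only [Fin.sum_univ_two]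
    refine R.add_mem (R.add_mem ?_ ((hs _).2 ⟨d1, by simpa using h1⟩))
      (R.add_mem ((ht _).2 ⟨d2, by simpa using h2⟩) ?_)
    · rw [← h0]; exact hdiag 0 d0
    · rw [← h3]; exact hdiag 1 d3

/-- A singular element outside the square of the radical, in the presence of idempotents. -/
theorem exists_mem_jacobson_of_entryEmb_mem (hR : IsOrder K R)
    (hu : ∀ i, entryEmb D u i i 1 ∈ R) :
    ∃ z : R, z ∈ Ring.jacobson R ∧ z ∉ Ring.jacobson R ^ 2 ∧ hR.norm z = 0 := by
  let J : Submodule D (Matrix (Fin 2) (Fin 2) K) :=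
    ((Ring.jacobson R).restrictScalars D).map R.val.toLinearMap
  have hJ : ∀ x : R, (x : Matrix (Fin 2) (Fin 2) K) ∈ J ↔ x ∈ Ring.jacobson R := fun x =>
    ⟨fun ⟨y, hy, hyx⟩ => Subtype.ext hyx ▸ hy, fun h => ⟨x, h, rfl⟩⟩
  have hJR : J ≤ Subalgebra.toSubmodule R := by
    rintro _ ⟨y, -, rfl⟩; exact y.2
  let M := J.comap (entryEmb D u 0 1)
  have hdiag : ∀ i, ∀ x ∈ Ring.jacobson R, ∃ d ∈ maximalIdeal D,
      algebraMap D K d = ((u⁻¹).val * (x : Matrix (Fin 2) (Fin 2) K) * u.val) i i := by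
    intro i x hx
    refine ⟨_, (hR.mem_jacobson_iff.1 hx).2 ⟨_, hu i⟩, ?_⟩
    rw [hR.algebraMap_tr, entry_eq_trace (D := D)]; rfl
  have hoff : ∀ x ∈ Ring.jacobson R,
      ((u⁻¹).val * (x : Matrix (Fin 2) (Fin 2) K) * u.val) 0 1 ∈ M := by
    intro x hx
    change entryEmb D u 0 1 _ ∈ J
    rw [entryEmb_eq_mul_mul]
    have h1 : (⟨_, hu 0⟩ : R) * x * (⟨_, hu 1⟩ : R) ∈ Ring.jacobson R :=
      (Ring.jacobson R).mul_mem_right _ ((Ring.jacobson R).mul_mem_left _ hx)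
    have h2 := (hJ _).2 h1
    rwa [R.coe_mul, R.coe_mul] at h2
  -- Diagonal entries of `J` lie in the maximal ideal, so the upper right entry of a product gains a
  -- factor from it.
  have hsq : ∀ x ∈ Ring.jacobson R ^ 2,
      ((u⁻¹).val * (x : Matrix (Fin 2) (Fin 2) K) * u.val) 0 1 ∈ maximalIdeal D • M := by
    intro x hx
    rw [ideal_sq_eq_mul] at hx
    refine Submodule.mul_induction_on (C := fun x : R => ((u⁻¹).val *
      (x : Matrix (Fin 2) (Fin 2) K) * u.val) 0 1 ∈ maximalIdeal D • M) hx ?_ ?_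
    · intro x hx y hy
      have hxy : (u⁻¹).val * ((x * y : R) : Matrix (Fin 2) (Fin 2) K) * u.val =
          ((u⁻¹).val * x * u.val) * ((u⁻¹).val * y * u.val) := by
        simp only [R.coe_mul, mul_assoc, Units.mul_inv_cancel_left]
      rw [hxy]
      exact mul_apply_zero_one_mem_smul (hdiag 0 x hx) (hoff x hx) (hdiag 1 y hy) (hoff y hy)
    · intro x y hx hy
      have hxy : (u⁻¹).val * ((x + y : R) : Matrix (Fin 2) (Fin 2) K) * u.val =
          ((u⁻¹).val * x * u.val) + ((u⁻¹).val * y * u.val) := by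
        rw [R.coe_add, mul_add, add_mul]
      rw [hxy]
      exact Submodule.add_mem _ hx hy
  have hM0 : M ≠ ⊥ := by
    obtain ⟨ϖ, hϖ⟩ := IsDiscreteValuationRing.exists_irreducible D
    obtain ⟨d, hd, hmem⟩ := hR.exists_smul_mem (entryEmb D u 0 1 1)
    have h1 : (ϖ * d) • (1 : K) ∈ M := by
      change entryEmb D u 0 1 _ ∈ J
      rw [map_smul, mul_smul]
      exact (hJ (ϖ • ⟨_, hmem⟩)).2 (hR.smul_mem_jacobson hϖ.not_isUnit _)
    intro h0
    rw [h0, Submodule.mem_bot, Algebra.smul_def, mul_one] at h1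
    exact mul_ne_zero hϖ.ne_zero hd (by simpa using h1)
  obtain ⟨t, ht, htM⟩ : ∃ t ∈ M, t ∉ maximalIdeal D • M := by
    by_contra! h
    exact hM0 (Submodule.eq_bot_of_le_smul_of_le_jacobson_bot _ M (hR.fg_comap_entryEmb hJR 0 1) h
      (IsLocalRing.maximalIdeal_le_jacobson _))
  obtain ⟨z, hz, hzt⟩ := ht
  have hzt' : (z : Matrix (Fin 2) (Fin 2) K) = entryEmb D u 0 1 t := hzt
  refine ⟨z, hz, fun h => htM ?_, IsFractionRing.injective D K ?_⟩
  · have h1 := hsq z h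
    rwa [hzt', inv_mul_entryEmb_mul, Matrix.single_apply_same] at h1
  · rw [hR.algebraMap_norm, hzt', entryEmb_apply, Matrix.det_mul, Matrix.det_mul, map_zero]
    simp [Matrix.det_fin_two]

end IsOrder

/-! ### Local orders modulo the uniformizer. -/

/-- A linear relation over the fraction field of a valuation ring can be scaled to a relation over
the ring in which some coefficient is a unit. -/
theorem exists_smul_sum_eq_zero_of_finrank_lt {D K V ι : Type*} [CommRing D] [IsDomain D]
    [ValuationRing D] [Field K] [Algebra D K] [IsFractionRing D K] [AddCommGroup V] [Module K V]
    [FiniteDimensional K V] [Module D V] [IsScalarTower D K V] [Fintype ι] (v : ι → V)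
    (h : Module.finrank K V < Fintype.card ι) :
    ∃ d : ι → D, ∑ i, d i • v i = 0 ∧ ∃ i, IsUnit (d i) := by
  have hdep : ¬ LinearIndependent K v := fun hli => h.not_ge hli.fintype_card_le_finrank
  obtain ⟨g, hg, i₀, hi₀⟩ := Fintype.not_linearIndependent_iff.1 hdep
  have : Nonempty ι := ⟨i₀⟩
  -- Dividing by a coefficient of maximal valuation makes all coefficients integral and that one
  -- equal to 1.
  obtain ⟨i, hi⟩ := Finite.exists_max fun j => ValuationRing.valuation D K (g j)
  have hgi : g i ≠ 0 := fun h0 => by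
    have := hi i₀
    rw [h0, map_zero, le_zero_iff, map_eq_zero] at this
    exact hi₀ this
  have hint : ∀ j, ∃ d, algebraMap D K d = g j / g i := fun j => by
    rw [← ValuationRing.mem_integer_iff, Valuation.mem_integer_iff, map_div₀]
    exact div_le_one_of_le₀ (hi j) zero_le
  choose d hd using hint
  refine ⟨d, ?_, i, ?_⟩
  · have : ∑ j, d j • v j = (g i)⁻¹ • ∑ j, g j • v j := by
      rw [Finset.smul_sum]
      refine Finset.sum_congr rfl fun j _ => ?_
      rw [← algebraMap_smul K, hd, smul_smul, div_eq_inv_mul]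
    rw [this, hg, smul_zero]
  · have : d i = 1 := IsFractionRing.injective D K (by rw [hd, div_self hgi, map_one])
    rw [this]; exact isUnit_one

/-- Multiplication in the algebra generated by two anticommuting elements of square zero. -/
theorem mul_eq_smul_of_anticomm {D B : Type*} [CommRing D] [Ring B] [Algebra D B] {x y : B}
    (hx : x * x = 0) (hy : y * y = 0) (hxy : y * x = -(x * y)) (a b c a' b' c' : D) :
    (a • x + b • y + c • (x * y)) * (a' • x + b' • y + c' • (x * y)) =
      (a * b' - b * a') • (x * y) := by
  have h1 : x * (x * y) = 0 := by rw [← mul_assoc, hx, zero_mul]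
  have h2 : x * y * y = 0 := by rw [mul_assoc, hy, mul_zero]
  have h3 : y * (x * y) = 0 := by rw [← mul_assoc, hxy, neg_mul, h2, neg_zero]
  have h4 : x * y * x = 0 := by rw [mul_assoc, hxy, mul_neg, h1, neg_zero]
  have h5 : x * y * (x * y) = 0 := by rw [mul_assoc, h3, mul_zero]
  simp only [add_mul, mul_add, smul_mul_smul_comm, hx, hy, hxy, h1, h2, h3, h4, h5]
  module

theorem sum_four {D M : Type*} [CommRing D] [AddCommGroup M] [Module D M] (d : Fin 4 → D)
    (a b c e : M) :
    ∑ i, d i • ![a, b, c, e] i = d 0 • a + (d 1 • b + d 2 • c + d 3 • e) := by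
  simp only [Fin.sum_univ_four, Matrix.cons_val]
  abel

/-- The two-sided ideal generated by a scalar. -/
def scalarIdeal {D : Type*} (S : Type*) [CommRing D] [Ring S] [Algebra D S] (ϖ : D) : Ideal S where
  carrier := {a | ∃ r, ϖ • r = a}
  zero_mem' := ⟨0, smul_zero _⟩
  add_mem' := by
    rintro _ _ ⟨r, rfl⟩ ⟨s, rfl⟩
    exact ⟨r + s, smul_add _ _ _⟩
  smul_mem' := by
    rintro s _ ⟨r, rfl⟩
    exact ⟨s * r, by rw [smul_eq_mul, mul_smul_comm]⟩

instance {D : Type*} (S : Type*) [CommRing D] [Ring S] [Algebra D S] (ϖ : D) :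
    (scalarIdeal S ϖ).IsTwoSided where
  mul_mem_of_left := by
    rintro _ s ⟨r, rfl⟩
    exact ⟨r * s, by rw [smul_mul_assoc]⟩

namespace IsOrder

variable {D K : Type*} [CommRing D] [IsDomain D] [IsDiscreteValuationRing D]
    [Field K] [Algebra D K] [IsFractionRing D K]
    {R : Subalgebra D (Matrix (Fin 2) (Fin 2) K)}

theorem mul_self_mem_scalarIdeal (hR : IsOrder K R) {ϖ : D} (hϖ : Irreducible ϖ) {x : R}
    (hx : x ∈ Ring.jacobson R) : x * x ∈ scalarIdeal R ϖ := by
  obtain ⟨h1, h2⟩ := hR.mem_jacobson_iff.1 hx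
  have h3 := h2 1
  have h4 := hR.norm_mem_iff.2 h1
  rw [one_mul] at h3
  rw [hϖ.maximalIdeal_eq, Ideal.mem_span_singleton] at h3 h4
  obtain ⟨t, ht⟩ := h3
  obtain ⟨d, hd⟩ := h4
  refine ⟨t • x - d • 1, ?_⟩
  rw [hR.mul_self, ht, hd, mul_smul, mul_smul, smul_sub]

/-- Four elements of an order that are linearly independent modulo the uniformizer span it. -/
theorem exists_eq_sum_smul_of_indep {ϖ : D} (hϖ : Irreducible ϖ) (v : Fin 4 → R)
    (hv : ∀ d : Fin 4 → D, ∑ i, d i • v i ∈ scalarIdeal R ϖ → ∀ i, d i ∈ maximalIdeal D) (r : R) :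
    ∃ d : Fin 4 → D, r = ∑ i, d i • v i := by
  obtain ⟨d, hd, i, hi⟩ := exists_smul_sum_eq_zero_of_finrank_lt (D := D) (K := K)
    (fun i => ((Fin.cons r v : Fin 5 → R) i : Matrix (Fin 2) (Fin 2) K))
    (by simp [Module.finrank_matrix])
  have hd' : d 0 • r + ∑ i : Fin 4, d i.succ • v i = 0 := by
    apply Subtype.ext
    rw [Fin.sum_univ_succ] at hd
    simpa using hd
  -- Otherwise the relation reduces to one among the `v i` modulo `ϖ`, and no coefficient would be a
  -- unit.
  have h0 : IsUnit (d 0) := by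
    by_contra h0
    have h0' : d 0 ∈ maximalIdeal D := h0
    rw [hϖ.maximalIdeal_eq, Ideal.mem_span_singleton] at h0'
    obtain ⟨e, he⟩ := h0'
    have h1 := hv (fun i => d i.succ) ⟨-(e • r), by
      rw [smul_neg, smul_smul, ← he, neg_eq_iff_add_eq_zero]; exact hd'⟩
    rcases Fin.eq_zero_or_eq_succ i with rfl | ⟨j, rfl⟩
    · exact h0 hi
    · exact h1 j hi
  obtain ⟨u, hu⟩ := h0.exists_left_inv
  refine ⟨fun i => -(u * d i.succ), ?_⟩
  simp only [neg_smul, mul_smul, Finset.sum_neg_distrib, ← Finset.smul_sum]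
  rw [← smul_neg, ← eq_neg_of_add_eq_zero_left hd', smul_smul, hu, one_smul]

/-- The square of the radical is generated by one element modulo the uniformizer
of the base ring. -/
theorem exists_mul_mem_span_add (hR : IsOrder K R) {ϖ : D} (hϖ : Irreducible ϖ) :
    ∃ c : R, ∀ r ∈ Ring.jacobson R, ∀ s ∈ Ring.jacobson R,
      ∃ (d : D) (q : R), r * s = d • c + ϖ • q := by
  by_cases hzero : ∀ r ∈ Ring.jacobson R, ∀ s ∈ Ring.jacobson R, r * s ∈ scalarIdeal R ϖ
  · refine ⟨0, fun r hr s hs => ?_⟩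
    obtain ⟨q, hq⟩ := hzero r hr s hs
    exact ⟨0, q, by rw [hq, smul_zero, zero_add]⟩
  push Not at hzero
  obtain ⟨x, hx, y, hy, hxy⟩ := hzero
  let φ := Ideal.Quotient.mk (scalarIdeal R ϖ)
  have hφ : ∀ {a}, φ a = 0 ↔ a ∈ scalarIdeal R ϖ := Ideal.Quotient.eq_zero_iff_mem
  have hsmul : ∀ (d : D) (a : R), φ (d • a) = d • φ a := fun _ _ => rfl
  have hunit : ∀ {d : D} {b : R ⧸ scalarIdeal R ϖ}, d • b = 0 → b ≠ 0 → d ∈ maximalIdeal D := by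
    intro d b h hb hd
    obtain ⟨e, he⟩ := IsUnit.exists_left_inv hd
    exact hb (by rw [← one_smul D b, ← he, mul_smul, h, smul_zero])
  have hsq : ∀ {a}, a ∈ Ring.jacobson R → φ a * φ a = 0 := fun ha => by
    rw [← map_mul, hφ]; exact hR.mul_self_mem_scalarIdeal hϖ ha
  have hxx := hsq hx
  have hyy := hsq hy
  have hyx : φ y * φ x = -(φ x * φ y) := by
    have h := hsq (Ideal.add_mem _ hx hy)
    rw [map_add, mul_add, add_mul, add_mul, hxx, hyy, zero_add, add_zero] at h
    exact eq_neg_of_add_eq_zero_left h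
  have hne : φ x * φ y ≠ 0 := by rw [← map_mul]; exact fun h => hxy (hφ.1 h)
  have hsc : ∀ d : D, d • (1 : R) ∈ Ring.jacobson R → d ∈ maximalIdeal D := fun d hd => by
    have := hR.norm_mem_iff.2 (hR.mem_jacobson_iff.1 hd).1
    rw [hR.norm_smul, map_one, mul_one] at this
    exact Ideal.IsPrime.mem_of_pow_mem inferInstance 2 this
  have hlin : ∀ d ∈ maximalIdeal D, ∀ a, φ (d • a) = 0 := fun d hd a => by
    rw [hϖ.maximalIdeal_eq, Ideal.mem_span_singleton] at hd
    obtain ⟨e, rfl⟩ := hd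
    exact hφ.2 ⟨e • a, (mul_smul _ _ _).symm⟩
  have hJ : ∀ a b c : D, a • x + b • y + c • (x * y) ∈ Ring.jacobson R := fun a b c =>
    Ideal.add_mem _ (Ideal.add_mem _ (Submodule.smul_of_tower_mem _ a hx)
      (Submodule.smul_of_tower_mem _ b hy))
      (Submodule.smul_of_tower_mem _ c (Ideal.mul_mem_left _ x hy))
  -- The radical isolates `e`; then right multiplication by `y` isolates `a` and left multiplication
  -- by `x` isolates `b`.
  have hindep : ∀ e a b c : D, φ (e • 1 + (a • x + b • y + c • (x * y))) = 0 →
      e ∈ maximalIdeal D ∧ a ∈ maximalIdeal D ∧ b ∈ maximalIdeal D ∧ c ∈ maximalIdeal D := by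
    intro e a b c h
    have he : e ∈ maximalIdeal D := by
      obtain ⟨q, hq⟩ := hφ.1 h
      refine hsc e ((Submodule.add_mem_iff_left _ (hJ a b c)).1 ?_)
      rw [← hq]
      exact hR.smul_mem_jacobson hϖ.not_isUnit q
    rw [map_add, hlin e he, zero_add, map_add, map_add, hsmul, hsmul, hsmul, map_mul] at h
    have h1 : a • (φ x * φ y) = 0 := by
      have := mul_eq_smul_of_anticomm hxx hyy hyx a b c 0 1 0
      rw [h, zero_mul, mul_one, mul_zero, sub_zero] at this
      exact this.symm
    have h2 : b • (φ x * φ y) = 0 := by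
      have := mul_eq_smul_of_anticomm hxx hyy hyx 1 0 0 a b c
      rw [h, mul_zero, one_mul, zero_mul, sub_zero] at this
      exact this.symm
    have ha := hunit h1 hne
    have hb := hunit h2 hne
    rw [← hsmul a, ← hsmul b, hlin a ha, hlin b hb, zero_add, zero_add] at h
    exact ⟨he, ha, hb, hunit h hne⟩
  have hgen : ∀ r : R, ∃ e a b c : D, r = e • 1 + (a • x + b • y + c • (x * y)) := by
    intro r
    obtain ⟨d, hd⟩ := exists_eq_sum_smul_of_indep hϖ ![1, x, y, x * y] (fun d h => by
      rw [sum_four] at h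
      obtain ⟨k1, k2, k3, k4⟩ := hindep _ _ _ _ (hφ.2 h)
      exact Fin.forall_fin_succ.2 ⟨k1, Fin.forall_fin_succ.2 ⟨k2, Fin.forall_fin_two.2 ⟨k3, k4⟩⟩⟩) r
    exact ⟨d 0, d 1, d 2, d 3, hd.trans (sum_four d _ _ _ _)⟩
  have hgenJ : ∀ r ∈ Ring.jacobson R, ∃ a b c : D, φ r = a • φ x + b • φ y + c • (φ x * φ y) := by
    intro r hr
    obtain ⟨e, a, b, c, rfl⟩ := hgen r
    have he := hsc e ((Submodule.add_mem_iff_left _ (hJ a b c)).1 hr)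
    refine ⟨a, b, c, ?_⟩
    rw [map_add, hlin e he, zero_add]; rfl
  refine ⟨x * y, fun r hr s hs => ?_⟩
  obtain ⟨a, b, c, h1⟩ := hgenJ r hr
  obtain ⟨a', b', c', h2⟩ := hgenJ s hs
  have h3 : φ (r * s - (a * b' - b * a') • (x * y)) = 0 := by
    rw [map_sub, map_mul, h1, h2, mul_eq_smul_of_anticomm hxx hyy hyx, hsmul, map_mul, sub_self]
  obtain ⟨q, hq⟩ := hφ.1 h3
  exact ⟨_, q, by rw [hq]; abel⟩

/-- The matrices in an order whose second column vanishes. -/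
def firstColumn (R : Subalgebra D (Matrix (Fin 2) (Fin 2) K)) : Submodule D R where
  carrier := {x | ∀ i, (x : Matrix (Fin 2) (Fin 2) K) i 1 = 0}
  zero_mem' _ := rfl
  add_mem' ha hb i := by simp [ha i, hb i]
  smul_mem' d a ha i := by simp [ha i]

theorem norm_eq_zero_of_mem_firstColumn (hR : IsOrder K R) {x : R} (hx : x ∈ firstColumn R) :
    hR.norm x = 0 :=
  IsFractionRing.injective D K (by
    rw [hR.algebraMap_norm, Matrix.det_fin_two, hx 0, hx 1]; simp)

/-- Multiples of both first-column matrix units lie in `R`, so the module has rank two. -/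
theorem not_firstColumn_le_span_singleton (hR : IsOrder K R) (w : R) :
    ¬ firstColumn R ≤ Submodule.span D {w} := by
  intro h
  have key : ∀ i, ∃ a d : D, d ≠ 0 ∧
      a • (w : Matrix (Fin 2) (Fin 2) K) = d • Matrix.single i 0 1 := fun i => by
    obtain ⟨d, hd, hmem⟩ := hR.exists_smul_mem (Matrix.single i 0 1)
    obtain ⟨a, ha⟩ := Submodule.mem_span_singleton.1
      (h (x := ⟨_, hmem⟩) fun j => by simp)
    exact ⟨a, d, hd, congrArg Subtype.val ha⟩
  obtain ⟨a, d, hd, h0⟩ := key 0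
  obtain ⟨b, e, he, h1⟩ := key 1
  have h00 := congrFun (congrFun h0 0) 0
  have h01 := congrFun (congrFun h0 1) 0
  have h11 := congrFun (congrFun h1 1) 0
  rw [Matrix.smul_apply, Matrix.smul_apply, Algebra.smul_def, Algebra.smul_def] at h00 h01 h11
  simp at h00 h01 h11
  rcases h01 with h01 | h01
  · rw [h01, map_zero, zero_mul] at h00
    exact hd (by simpa using h00.symm)
  · rw [h01, mul_zero] at h11
    exact he (by simpa using h11.symm)

/-- A singular element outside the square of the radical of a local order. -/
theorem exists_notMem_jacobson_sq_of_local (hR : IsOrder K R)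
    (hloc : ∀ x : R, ¬ IsUnit x → x ∈ Ring.jacobson R) :
    ∃ z : R, z ∈ Ring.jacobson R ∧ z ∉ Ring.jacobson R ^ 2 ∧ hR.norm z = 0 := by
  obtain ⟨ϖ, hϖ⟩ := IsDiscreteValuationRing.exists_irreducible D
  by_contra! hno
  obtain ⟨c, hc⟩ := hR.exists_mul_mem_span_add hϖ
  have hsq : ∀ x ∈ Ring.jacobson R ^ 2, ∃ (d : D) (q : R), x = d • c + ϖ • q := by
    intro x hx
    rw [ideal_sq_eq_mul] at hx
    refine Submodule.mul_induction_on
      (C := fun x : R => ∃ (d : D) (q : R), x = d • c + ϖ • q) hx hc ?_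
    rintro _ _ ⟨d, q, rfl⟩ ⟨d', q', rfl⟩
    exact ⟨d + d', q + q', by module⟩
  have hcol : ∀ x ∈ firstColumn R, ∃ (d : D) (q : R), x = d • c + ϖ • q := by
    intro x hx
    have hx0 := hR.norm_eq_zero_of_mem_firstColumn hx
    refine hsq x (by_contra fun h => hno x (hloc x ?_) h hx0)
    rw [← hR.norm_mem_iff, hx0]
    exact Ideal.zero_mem _
  have hdiv : ∀ q : R, ϖ • q ∈ firstColumn R → q ∈ firstColumn R := by
    intro q hq i
    have h1 := hq i
    rw [R.coe_smul, Matrix.smul_apply, Algebra.smul_def] at h1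
    exact (mul_eq_zero.1 h1).resolve_left (by simpa using hϖ.ne_zero)
  have hϖm : ϖ ∈ maximalIdeal D := hϖ.not_isUnit
  have hfin : Module.Finite D R := Module.Finite.iff_fg.2 hR.fg
  have hfg : (firstColumn R).FG := IsNoetherian.noetherian _
  -- If the column module lay in `J²`, it would be cyclic modulo the maximal ideal, hence cyclic by
  -- Nakayama. Saturation (`hdiv`) turns divisibility by `ϖ` in `R` into divisibility within the
  -- module.
  obtain ⟨w, hw⟩ : ∃ w, firstColumn R ≤
      Submodule.span D {w} ⊔ maximalIdeal D • firstColumn R := by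
    by_cases hall : ∀ x ∈ firstColumn R, ∃ q, x = ϖ • q
    · refine ⟨0, fun x hx => Submodule.mem_sup_right ?_⟩
      obtain ⟨q, rfl⟩ := hall x hx
      exact Submodule.smul_mem_smul hϖm (hdiv q hx)
    · push Not at hall
      obtain ⟨w, hw, hwq⟩ := hall
      obtain ⟨a, q, haq⟩ := hcol w hw
      -- As `w` is not divisible by `ϖ`, its coefficient at `c` is a unit, so `w` can replace `c` as
      -- generator modulo `ϖ`.
      have ha : IsUnit a := by
        by_contra ha
        have ha' : a ∈ maximalIdeal D := ha
        rw [hϖ.maximalIdeal_eq, Ideal.mem_span_singleton] at ha'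
        obtain ⟨b, rfl⟩ := ha'
        exact hwq (b • c + q) (by rw [haq]; module)
      obtain ⟨b, hb⟩ := ha.exists_left_inv
      refine ⟨w, fun x hx => ?_⟩
      obtain ⟨d, p, hdp⟩ := hcol x hx
      have h1 : b • (a • c) = c := by rw [smul_smul, hb, one_smul]
      have hx' : x - (d * b) • w = ϖ • (p - (d * b) • q) := by
        have h3 : d • c = (d * b) • (a • c) := by rw [mul_smul, h1]
        rw [hdp, haq, h3]
        module
      have h2 : p - (d * b) • q ∈ firstColumn R := hdiv _ (by
        rw [← hx']
        exact Submodule.sub_mem _ hx (Submodule.smul_mem _ _ hw))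
      rw [← sub_add_cancel x ((d * b) • w), hx', add_comm]
      exact Submodule.add_mem_sup (Submodule.smul_mem _ _ (Submodule.mem_span_singleton_self w))
        (Submodule.smul_mem_smul hϖm h2)
  exact hR.not_firstColumn_le_span_singleton w
    (Submodule.le_of_le_smul_of_le_jacobson_bot hfg (IsLocalRing.maximalIdeal_le_jacobson _) hw)

end IsOrder

theorem mainTheorem3 {D K : Type*} [CommRing D] [IsDomain D] [IsDiscreteValuationRing D]
    [Field K] [Algebra D K] [IsFractionRing D K]
    (R : Subalgebra D (Matrix (Fin 2) (Fin 2) K)) (hR : IsOrder K R) :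
    (∃ z : R, z ∈ Ring.jacobson R ∧ z ∉ Ring.jacobson R ^ 2 ∧
      nr (z : Matrix (Fin 2) (Fin 2) K) = 0) ∧
    (¬ IsEichlerOrder K R →
      (∃ N : ℕ, ∀ n : ℕ, N ≤ n → ∃ u : R⁰, Irreducible u ∧
        sv D (nr ((u : R) : Matrix (Fin 2) (Fin 2) K)) = (((2 * n : ℕ) : ℤ) : WithTop ℤ)) ∧
      elasticity R⁰ = ⊤) := by
  by_cases hloc : ∀ x : R, ¬ IsUnit x → x ∈ Ring.jacobson R
  · obtain ⟨z, hz, hz2, hz0⟩ := hR.exists_notMem_jacobson_sq_of_local hloc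
    obtain ⟨ϖ, hϖ⟩ := IsDiscreteValuationRing.exists_irreducible D
    obtain ⟨N, hN⟩ := hR.exists_irreducible_norm hloc hz2 hz0 hϖ
    refine ⟨⟨z, hz, hz2, by rw [nr, ← hR.algebraMap_norm, hz0, map_zero]⟩, fun _ =>
      ⟨⟨N, fun n hn => ?_⟩, hR.elasticity_eq_top hϖ hN⟩⟩
    obtain ⟨u, hu, hun⟩ := hN n hn
    refine ⟨u, hu, ?_⟩
    rw [nr, ← hR.algebraMap_norm]
    exact sv_algebraMap_of_associated hϖ hun
  · push Not at hloc
    obtain ⟨x, hx, hxJ⟩ := hloc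
    obtain ⟨e, he, he0⟩ := hR.exists_tr_eq_one_norm_eq_zero hx hxJ
    obtain ⟨u, hu⟩ := hR.exists_entryEmb_mem he he0
    obtain ⟨z, hz, hz2, hz0⟩ := hR.exists_mem_jacobson_of_entryEmb_mem hu
    exact ⟨⟨z, hz, hz2, by rw [nr, ← hR.algebraMap_norm, hz0, map_zero]⟩,
      fun hE => absurd (hR.isEichlerOrder hu) hE⟩
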